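/- Let $X$ be a $\mathbb{Z}_2$-CW complex, i.e. a Hausdorff CW complex with a continuous involution $\iota$ such that $\iota$ permutes the characteristic maps of the cells (so that a cell carried to itself is fixed pointwise). Let $E$ be any model of $E\mathbb{Z}_2$: a contractible space with a continuous involution $\tau$ such that $E\to E/\tau$ is a principal $\mathbb{Z}_2$-bundle. Write $E\times_{\mathbb{Z}_2}X$ for the quotient of $E\times X$ by the diagonal involution $(e,x)\mapsto(\tau e,\iota x)$, and put $$H^n_{\mathbb{Z}_2}(X)=H^n(E\times_{\mathbb{Z}_2}X;\mathbb{Z}),\qquad H^n_{\pm}(X)=H^n(E\times_{\mathbb{Z}_2}X;\mathbb{Z}(1)),$$ where the first group is integral singular cohomology and the second is singular cohomology with coefficients in the local system $\mathbb{Z}(1)=(E\times X\times\mathbb{Z})/\big((e,x,m)\sim(\tau e,\iota x,-m)\big)$. Equivalently, $H^n_\pm(X)$ is the cohomology of the complex of integral singular cochains $c$ on $E\times X$ that satisfy $c((\tau\times\iota)\circ s)=-c(s)$ for every singular simplex $s$. Let $\mathbb{T}_{\mathrm{triv}}$ and $\mathbb{T}_{\mathrm{conj}}$ be the unit circle in $\mathbb{C}$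 with the trivial involution and with complex conjugation, respectively, and let $[X,\mathbb{T}_{\mathrm{triv}}]_{\mathbb{Z}_2}$ and $[X,\mathbb{T}_{\mathrm{conj}}]_{\mathbb{Z}_2}$ be the groups, under pointwise multiplication, of equivariant homotopy classes of continuous equivariant maps from $X$. Then there are isomorphisms of groups $$H^1_{\mathbb{Z}_2}(X)\cong[X,\mathbb{T}_{\mathrm{triv}}]_{\mathbb{Z}_2},\qquad H^1_{\pm}(X)\cong[X,\mathbb{T}_{\mathrm{conj}}]_{\mathbb{Z}_2}.$$ -/

import Mathlib

noncomputable section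

namespace EquivCoh

universe u v

/-! ### Singular cochains -/

/-- The inclusion of the `i`-th face of the standard `(n + 1)`-simplex. -/
def face {n : ℕ} (i : Fin (n + 2)) :
    C(stdSimplex ℝ (Fin (n + 1)), stdSimplex ℝ (Fin (n + 2))) :=
  ⟨stdSimplex.map i.succAbove, stdSimplex.continuous_map i.succAbove⟩

/-- Singular `n`-simplices of a space. -/
abbrev SingularSimplex (Y : Type u) [TopologicalSpace Y] (n : ℕ) : Type u :=
  C(stdSimplex ℝ (Fin (n + 1)), Y)

/-- Integral singular `n`-cochains: homomorphisms from the free abelian group on the singular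
`n`-simplices to `ℤ`, that is, functions on the singular `n`-simplices. -/
abbrev Cochain (Y : Type u) [TopologicalSpace Y] (n : ℕ) : Type u :=
  SingularSimplex Y n → ℤ

/-- The singular coboundary `(δ c)(s) = ∑ i, (-1)^i c(s ∘ face i)`. -/
def coboundary (Y : Type u) [TopologicalSpace Y] (n : ℕ) : Cochain Y n →+ Cochain Y (n + 1) where
  toFun c := fun s => ∑ i : Fin (n + 2), (-1 : ℤ) ^ (i : ℕ) * c (s.comp (face i))
  map_zero' := by
    funext s
    simp
  map_add' c c' := by
    funext s
    simp [mul_add, Finset.sum_add_distrib]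

section Subcomplex

variable {Y : Type u} [TopologicalSpace Y]

/-- The `n`-cocycles of a subcomplex `A` of the singular cochain complex. -/
def cocycles (A : ∀ n, AddSubgroup (Cochain Y n)) (n : ℕ) : AddSubgroup (Cochain Y n) :=
  A n ⊓ (coboundary Y n).ker

/-- The `n`-coboundaries of a subcomplex `A` of the singular cochain complex. -/
def coboundaries (A : ∀ n, AddSubgroup (Cochain Y n)) : ∀ n, AddSubgroup (Cochain Y n)
  | 0 => ⊥
  | n + 1 => (A n).map (coboundary Y n)

/-- The `n`-th cohomology group of a subcomplex `A` of the singular cochain complex. -/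
abbrev Cohomology (A : ∀ n, AddSubgroup (Cochain Y n)) (n : ℕ) : Type u :=
  cocycles A n ⧸ (coboundaries A n).addSubgroupOf (cocycles A n)

end Subcomplex

/-- Integral singular cohomology of a space. -/
abbrev SingularCohomology (Y : Type u) [TopologicalSpace Y] (n : ℕ) : Type u :=
  Cohomology (Y := Y) (fun _ => ⊤) n

/-- The cochains `c` on `Y` with `c (σ ∘ s) = - c s`, where `σ` is an involution of `Y`: the
homomorphisms of `ℤ[ℤ/2]`-modules from the singular chains of `Y` to `ℤ(1)`, where `ℤ(1)` is `ℤ`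
with the generator of `ℤ/2` acting as `-1`. -/
def antiInvariantCochains {Y : Type u} [TopologicalSpace Y] (σ : C(Y, Y)) (n : ℕ) :
    AddSubgroup (Cochain Y n) where
  carrier := {c | ∀ s : SingularSimplex Y n, c (σ.comp s) = - c s}
  zero_mem' := by
    intro s
    simp
  add_mem' := by
    intro c c' hc hc' s
    have h := hc s
    have h' := hc' s
    simp only [Pi.add_apply, h, h']
    ring
  neg_mem' := by
    intro c hc s
    have h := hc s
    simp only [Pi.neg_apply, h]

/-- The coboundary preserves anti-invariant cochains. -/
theorem coboundary_mem_antiInvariantCochains {Y : Type u} [TopologicalSpace Y] (σ : C(Y, Y))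
    (n : ℕ) {c : Cochain Y n} (hc : c ∈ antiInvariantCochains σ n) :
    coboundary Y n c ∈ antiInvariantCochains σ (n + 1) := by
  intro s
  have h : ∀ i : Fin (n + 2), c ((σ.comp s).comp (face i)) = - c (s.comp (face i)) :=
    fun i => hc (s.comp (face i))
  simp only [coboundary, AddMonoidHom.coe_mk, ZeroHom.coe_mk, h]
  simp

/-- Let `Y → Y / σ` be a double covering with covering involution `σ`, and let `ℤ(1)` be the local
system `(Y × ℤ) / ((y, m) ∼ (σ y, -m))` on `Y / σ`, in which a loop acts as `1` or `-1` according
to whether it lifts to a loop of `Y`. This is the cohomology of `Y / σ` with local coefficients in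
`ℤ(1)`, computed as usual from the equivariant cochains on the covering space `Y`. -/
abbrev TwistedCohomology {Y : Type u} [TopologicalSpace Y] (σ : C(Y, Y)) (n : ℕ) : Type u :=
  Cohomology (antiInvariantCochains σ) n

/-! ### The Borel construction -/

/-- The orbit relation of an involution. -/
def orbitSetoid {Y : Type u} (σ : Y → Y) (hσ : Function.Involutive σ) : Setoid Y where
  r p q := p = q ∨ σ p = q
  iseqv :=
    { refl := fun _ => Or.inl rfl
      symm := by
        rintro p q (rfl | rfl)
        · exact Or.inl rfl
        · exact Or.inr (hσ p)
      trans := by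
        rintro p q r (rfl | rfl) (rfl | rfl)
        · exact Or.inl rfl
        · exact Or.inr rfl
        · exact Or.inr rfl
        · exact Or.inl (hσ p).symm }

/-- A model `(E, τ)` of the universal free `ℤ/2`-space: a contractible space with a continuous
involution for which `E → E / τ` is a principal `ℤ/2`-bundle, that is, every point has an open
neighbourhood disjoint from its translate. -/
structure IsUniversalFree {E : Type v} [TopologicalSpace E] (τ : C(E, E)) : Prop where
  involutive : Function.Involutive τ
  contractible : ContractibleSpace E
  exists_disjoint : ∀ e : E, ∃ U : Set E, IsOpen U ∧ e ∈ U ∧ Disjoint U (τ '' U)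

section Borel

variable {E : Type v} [TopologicalSpace E] {X : Type u} [TopologicalSpace X]

/-- The diagonal involution on `E × X`. -/
abbrev diagonal (τ : C(E, E)) (ι : C(X, X)) : C(E × X, E × X) := τ.prodMap ι

theorem diagonal_involutive {τ : C(E, E)} {ι : C(X, X)} (hτ : Function.Involutive τ)
    (hι : Function.Involutive ι) : Function.Involutive (diagonal τ ι) := by
  rintro ⟨e, x⟩
  exact Prod.ext (hτ e) (hι x)

/-- The Borel construction `E ×_{ℤ/2} X`, with the quotient topology. -/
abbrev BorelConstruction (τ : C(E, E)) (ι : C(X, X)) (hτ : Function.Involutive τ)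
    (hι : Function.Involutive ι) : Type (max u v) :=
  Quotient (orbitSetoid (diagonal τ ι) (diagonal_involutive hτ hι))

/-- Borel equivariant cohomology `H^n_{ℤ/2}(X) = H^n(E ×_{ℤ/2} X; ℤ)`. -/
abbrev BorelCohomology (τ : C(E, E)) (ι : C(X, X)) (hτ : Function.Involutive τ)
    (hι : Function.Involutive ι) (n : ℕ) : Type (max u v) :=
  SingularCohomology (BorelConstruction τ ι hτ hι) n

/-- Twisted equivariant cohomology `H^n_±(X) = H^n_{ℤ/2}(X; ℤ(1))`: the cohomology of
`E ×_{ℤ/2} X` with coefficients in the local system `ℤ(1)` defined by the double covering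
`E × X → E ×_{ℤ/2} X`. -/
abbrev TwistedBorelCohomology (τ : C(E, E)) (ι : C(X, X)) (n : ℕ) : Type (max u v) :=
  TwistedCohomology (diagonal τ ι) n

end Borel

/-! ### `ℤ/2`-CW complexes -/

/-- A CW structure on `X` is a `ℤ/2`-CW structure for the involution `ι` when `ι` carries
characteristic maps to characteristic maps. If `j = i` below, the closed cell is fixed pointwise
and is a cell of type `(ℤ/2)/(ℤ/2) × D^n`; otherwise `i` and `j` make up a cell of type
`ℤ/2 × D^n`. -/
def IsZ2CW {X : Type u} [TopologicalSpace X] [Topology.CWComplex (Set.univ : Set X)] (ι : C(X, X)) : Prop :=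
  ∀ (n : ℕ) (i : Topology.RelCWComplex.cell (Set.univ : Set X) n),
    ∃ j : Topology.RelCWComplex.cell (Set.univ : Set X) n,
      ∀ x ∈ Metric.closedBall (0 : Fin n → ℝ) 1,
        ι (Topology.RelCWComplex.map n i x) = Topology.RelCWComplex.map n j x

/-! ### Equivariant homotopy classes of maps to the circle -/

/-- Complex conjugation on the unit circle. -/
def circleConj : Circle →* Circle where
  toFun z := ⟨starRingEnd ℂ z, mem_sphere_zero_iff_norm.2 ((RCLike.norm_conj (z : ℂ)).trans z.norm_coe)⟩
  map_one' := Circle.ext (map_one (starRingEnd ℂ))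
  map_mul' z w := Circle.ext (map_mul (starRingEnd ℂ) (z : ℂ) (w : ℂ))

section Maps

variable {X : Type u} [TopologicalSpace X]

/-- `f` is equivariant for the involution `ι` of `X` and the involution `θ` of the circle. -/
def IsEquivariant (ι : C(X, X)) (θ : Circle →* Circle) (f : C(X, Circle)) : Prop :=
  ∀ x, f (ι x) = θ (f x)

/-- The group of equivariant maps to the circle, under pointwise multiplication. -/
def equivariantMaps (ι : C(X, X)) (θ : Circle →* Circle) : Subgroup C(X, Circle) where
  carrier := {f | IsEquivariant ι θ f}
  one_mem' := by
    intro x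
    simp
  mul_mem' := by
    intro f g hf hg x
    have h := hf x
    have h' := hg x
    simp [h, h']
  inv_mem' := by
    intro f hf x
    have h := hf x
    simp [h]

/-- Equivariant homotopy (a homotopy all of whose stages are equivariant) is a congruence on the
group of equivariant maps. -/
def homotopyCon (ι : C(X, X)) (θ : Circle →* Circle) : Con (equivariantMaps ι θ) where
  r f g := ContinuousMap.HomotopicWith (f : C(X, Circle)) (g : C(X, Circle)) (IsEquivariant ι θ)
  iseqv :=
    { refl := fun f => ContinuousMap.HomotopicWith.refl f.1 f.2
      symm := fun h => h.symm
      trans := fun h h' => h.trans h' }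
  mul' := by
    rintro f f' g g' ⟨F⟩ ⟨G⟩
    refine ⟨⟨⟨⟨fun p => F p * G p, by fun_prop⟩, ?_, ?_⟩, ?_⟩⟩
    · intro x
      simp
    · intro x
      simp
    · intro t x
      have h := F.prop t x
      have h' := G.prop t x
      simp only [ContinuousMap.coe_mk] at h h' ⊢
      exact (congrArg₂ (· * ·) h h').trans (map_mul θ _ _).symm

/-- The group `[X, 𝕋]_{ℤ/2}` of equivariant homotopy classes of equivariant maps to the circle with
involution `θ`. -/
abbrev HomotopyClasses (ι : C(X, X)) (θ : Circle →* Circle) : Type u :=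
  (homotopyCon ι θ).Quotient

end Maps

end EquivCoh

end

/-!
A singular `1`-cocycle `c` integrates along paths. A possibly discontinuous function `φ` with values
in `ℝ` is regarded as a primitive of `c` if, along every map from a real vector space, it becomes
continuous after adding the integrals of `c`; since these are integers, `𝐞 ∘ φ` is then continuous
(`𝐞 x = exp (2 π i x)`), and `φ` determines `c`. On a CW complex primitives exist by extension over
one skeleton after the other, hence also on `E × X`, by contraction of `E`.

If `c` on `E × X` is multiplied by `ε = ±1` under the diagonal involution `σ`, averaging a primitive
`φ` with `ε (φ ∘ σ)` makes it equivariant, and then `𝐞 ∘ φ` is an equivariant map to the circle that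
comes from `X`. Conversely, as `σ` is free, an equivariant map lifts to an equivariant function with
values in `ℝ`, a primitive of the cocycle that compares it with continuous lifts along paths. Under
this correspondence coboundaries belong to lifts of the trivial map, hence to integer valued `φ`,
and homotopies belong to continuous lifts.

The sign `ε = -1` is the twisted case by definition. For `ε = 1`, the projection to the quotient is
a covering, and cochains on the quotient pull back bijectively to the invariant ones.
-/

noncomputable section

namespace EquivCoh

universe u v

open Topology Metric Set
open scoped FourierTransform

/-! ### Line integrals of singular `1`-cochains -/

section Pullback

variable {Y : Type u} [TopologicalSpace Y] {Z : Type v} [TopologicalSpace Z]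

/-- The pull-back of singular cochains along a continuous map. -/
def pullback (f : C(Y, Z)) (n : ℕ) : Cochain Z n →+ Cochain Y n where
  toFun c s := c (f.comp s)
  map_zero' := rfl
  map_add' _ _ := rfl

theorem coboundary_pullback (f : C(Y, Z)) (n : ℕ) (c : Cochain Z n) :
    coboundary Y n (pullback f n c) = pullback f (n + 1) (coboundary Z n c) := rfl

end Pullback

section LineIntegral

variable {V : Type*} [AddCommGroup V] [Module ℝ V] [TopologicalSpace V] [IsTopologicalAddGroup V]
  [ContinuousSMul ℝ V]
variable {W : Type*} [AddCommGroup W] [Module ℝ W] [TopologicalSpace W] [IsTopologicalAddGroup W]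
  [ContinuousSMul ℝ W]

/-- The affine singular simplex of a real vector space with given vertices. -/
def affineSimplex {n : ℕ} (v : Fin (n + 1) → V) : C(stdSimplex ℝ (Fin (n + 1)), V) where
  toFun s := ∑ i, s i • v i
  continuous_toFun := continuous_finsetSum _ fun i _ =>
    ((continuous_apply i).comp continuous_subtype_val).smul continuous_const

theorem affineSimplex_apply {n : ℕ} (v : Fin (n + 1) → V) (s : stdSimplex ℝ (Fin (n + 1))) :
    affineSimplex v s = ∑ i, s i • v i := rfl

theorem face_apply_self {n : ℕ} (i : Fin (n + 2)) (s : stdSimplex ℝ (Fin (n + 1))) :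
    face i s i = 0 := by
  simp [face, FunOnFinite.linearMap_apply_apply, Fin.succAbove_ne]

theorem face_apply_succAbove {n : ℕ} (i : Fin (n + 2)) (s : stdSimplex ℝ (Fin (n + 1)))
    (k : Fin (n + 1)) : face i s (i.succAbove k) = s k := by
  simp [face, FunOnFinite.linearMap_apply_apply, Finset.filter_eq']

theorem affineSimplex_comp_face {n : ℕ} (v : Fin (n + 2) → V) (i : Fin (n + 2)) :
    (affineSimplex v).comp (face i) = affineSimplex (v ∘ i.succAbove) := by
  ext s
  simp [affineSimplex_apply, Fin.sum_univ_succAbove _ i, face_apply_self, face_apply_succAbove]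

/-- The affine singular `1`-simplex from `p` to `q`. -/
def seg (p q : V) : C(stdSimplex ℝ (Fin 2), V) := affineSimplex ![p, q]

theorem seg_apply (p q : V) (s : stdSimplex ℝ (Fin 2)) : seg p q s = s 0 • p + s 1 • q := by
  simp [seg, affineSimplex_apply, Fin.sum_univ_two]

theorem seg_apply_eq_add_smul (p q : V) (s : stdSimplex ℝ (Fin 2)) :
    seg p q s = p + s 1 • (q - p) := by
  rw [seg_apply, eq_sub_of_add_eq (stdSimplex.add_eq_one s)]
  module

theorem seg_mem {K : Set V} (hK : Convex ℝ K) {p q : V} (hp : p ∈ K) (hq : q ∈ K)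
    (s : stdSimplex ℝ (Fin 2)) : seg p q s ∈ K := by
  rw [seg_apply]
  exact hK hp hq (stdSimplex.zero_le s 0) (stdSimplex.zero_le s 1) (stdSimplex.add_eq_one s)

variable {Y : Type u} [TopologicalSpace Y]

/-- The value of a singular `1`-cochain on the image under `f` of the straight segment from `p` to
`q`. -/
def lineIntegral (c : Cochain Y 1) (f : C(V, Y)) (p q : V) : ℤ := c (f.comp (seg p q))

theorem lineIntegral_eq_of_forall (c : Cochain Y 1) {f : C(V, Y)} {p q : V} {g : C(W, Y)}
    {p' q' : W} (h : ∀ s, f (seg p q s) = g (seg p' q' s)) :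
    lineIntegral c f p q = lineIntegral c g p' q' :=
  congrArg c (ContinuousMap.ext h)

theorem lineIntegral_congr (c : Cochain Y 1) {K : Set V} (hK : Convex ℝ K) {f g : C(V, Y)}
    (h : EqOn f g K) {p q : V} (hp : p ∈ K) (hq : q ∈ K) :
    lineIntegral c f p q = lineIntegral c g p q :=
  lineIntegral_eq_of_forall c fun s => h (seg_mem hK hp hq s)

theorem lineIntegral_coboundary (b : Cochain Y 0) (f : C(V, Y)) (p q : V) :
    lineIntegral (coboundary Y 0 b) f p q = b (.const _ (f q)) - b (.const _ (f p)) := by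
  have vertex (i : Fin 2) : (f.comp (seg p q)).comp (face i) =
      .const _ (f ((![p, q] ∘ i.succAbove) 0)) := by
    rw [ContinuousMap.comp_assoc, seg, affineSimplex_comp_face]
    ext t
    simp [affineSimplex_apply]
  change ∑ i : Fin 2, (-1 : ℤ) ^ (i : ℕ) * b ((f.comp (seg p q)).comp (face i)) = _
  simp [Fin.sum_univ_two, vertex, sub_eq_add_neg]

theorem coboundary_comp_affineSimplex (c : Cochain Y 1) (f : C(V, Y)) (v : Fin 3 → V) :
    coboundary Y 1 c (f.comp (affineSimplex v)) =
      lineIntegral c f (v 1) (v 2) - lineIntegral c f (v 0) (v 2) +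
        lineIntegral c f (v 0) (v 1) := by
  have edge (i : Fin 3) : (f.comp (affineSimplex v)).comp (face i) =
      f.comp (seg (v (i.succAbove 0)) (v (i.succAbove 1))) := by
    rw [ContinuousMap.comp_assoc, affineSimplex_comp_face, seg]
    congr 2
    ext j
    fin_cases j <;> rfl
  change ∑ i : Fin 3, (-1 : ℤ) ^ (i : ℕ) * c ((f.comp (affineSimplex v)).comp (face i)) = _
  simp only [Fin.sum_univ_three, edge]
  norm_num [lineIntegral, sub_eq_add_neg, Fin.succAbove, Fin.lt_def]

/-- A singular `1`-cochain is a cocycle if its coboundary vanishes. -/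
def IsCocycle (c : Cochain Y 1) : Prop := coboundary Y 1 c = 0

namespace IsCocycle

variable {c : Cochain Y 1} (hc : IsCocycle c)
include hc

theorem lineIntegral_add (f : C(V, Y)) (p q r : V) :
    lineIntegral c f p q + lineIntegral c f q r = lineIntegral c f p r := by
  have triangle := congrFun hc (f.comp (affineSimplex ![p, q, r]))
  rw [coboundary_comp_affineSimplex] at triangle
  change lineIntegral c f q r - lineIntegral c f p r + lineIntegral c f p q = 0 at triangle
  linarith

theorem lineIntegral_self (f : C(V, Y)) (p : V) : lineIntegral c f p p = 0 := by
  linarith [hc.lineIntegral_add f p p p]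

theorem apply_const (y : Y) : c (.const _ y) = 0 := by
  simpa [lineIntegral, ContinuousMap.const_comp] using hc.lineIntegral_self (.const ℝ y) 0

theorem lineIntegral_of_forall_eq {f : C(V, Y)} {p q : V} {y : Y} (h : ∀ s, f (seg p q s) = y) :
    lineIntegral c f p q = 0 := by
  rw [lineIntegral, show f.comp (seg p q) = .const _ y from ContinuousMap.ext h, hc.apply_const]

/-- The segments joining the base point `w a` to the points `w x` sweep out a homotopy, along which
the integral of a cocycle does not change. -/
theorem lineIntegral_comp (f : C(V, Y)) (w : C(W, V)) (a b : W) :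
    lineIntegral c (f.comp w) a b = lineIntegral c f (w a) (w b) := by
  let F : C(W × ℝ, Y) := f.comp ⟨fun z => w a + z.2 • (w z.1 - w a), by fun_prop⟩
  have bottom : lineIntegral c F (a, 0) (b, 0) = 0 :=
    hc.lineIntegral_of_forall_eq (y := f (w a)) fun s => by simp [F, seg_apply]
  have left : lineIntegral c F (a, 0) (a, 1) = 0 :=
    hc.lineIntegral_of_forall_eq (y := f (w a)) fun s => by simp [F, seg_apply_eq_add_smul]
  have right : lineIntegral c F (b, 0) (b, 1) = lineIntegral c f (w a) (w b) :=
    lineIntegral_eq_of_forall c fun s => by simp [F, seg_apply_eq_add_smul]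
  have top : lineIntegral c F (a, 1) (b, 1) = lineIntegral c (f.comp w) a b :=
    lineIntegral_eq_of_forall c fun s => by simp [F, seg_apply_eq_add_smul]
  linarith [hc.lineIntegral_add F (a, 0) (b, 0) (b, 1), hc.lineIntegral_add F (a, 0) (a, 1) (b, 1)]

theorem pullback {Z : Type v} [TopologicalSpace Z] (g : C(Z, Y)) :
    IsCocycle (pullback g 1 c) := by
  rw [IsCocycle, coboundary_pullback, hc, map_zero]

end IsCocycle

end LineIntegral

/-! ### Singular simplices as restrictions of maps from real vector spaces -/

section SimplexRetraction

/-- The retraction of `ℝⁿ⁺¹` onto the standard simplex that replaces negative coordinates by `0`,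
distributes the missing mass evenly if the coordinates add up to less than `1`, and rescales
otherwise. -/
def simplexRetraction (n : ℕ) : C(Fin (n + 1) → ℝ, stdSimplex ℝ (Fin (n + 1))) where
  toFun v := ⟨fun i => (max (v i) 0 + max (1 - ∑ j, max (v j) 0) 0 / (n + 1)) /
      max (∑ j, max (v j) 0) 1, fun i => by positivity, by
    rw [← Finset.sum_div, Finset.sum_add_distrib]
    generalize (∑ j, max (v j) 0) = S
    have : S + max (1 - S) 0 = max S 1 := by
      rw [max_comm, ← max_add_add_left, add_zero, add_sub_cancel]
    simp only [Finset.sum_const, Finset.card_univ, Fintype.card_fin, nsmul_eq_mul]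
    push_cast
    rw [mul_div_cancel₀ _ (by positivity : (n : ℝ) + 1 ≠ 0), this, div_self (by positivity)]⟩
  continuous_toFun := by
    refine Continuous.subtype_mk (continuous_pi fun i => .div (by fun_prop) (by fun_prop) ?_) _
    intro v
    positivity

theorem simplexRetraction_coe {n : ℕ} (s : stdSimplex ℝ (Fin (n + 1))) :
    simplexRetraction n s = s := by
  ext i
  change (max (s i) 0 + max (1 - ∑ j, max (s j) 0) 0 / (n + 1)) / max (∑ j, max (s j) 0) 1 = s i
  simp

theorem affineSimplex_single {n : ℕ} (s : stdSimplex ℝ (Fin (n + 1))) :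
    affineSimplex (fun i => (Pi.single i 1 : Fin (n + 1) → ℝ)) s = s := by
  rw [affineSimplex_apply]
  ext j
  simp [Finset.sum_apply, Pi.single_apply]

variable {Y : Type u} [TopologicalSpace Y]

theorem exists_eq_comp_affineSimplex {n : ℕ} (s : SingularSimplex Y n) :
    ∃ (f : C(Fin (n + 1) → ℝ, Y)) (v : Fin (n + 1) → Fin (n + 1) → ℝ),
      s = f.comp (affineSimplex v) := by
  refine ⟨s.comp (simplexRetraction n), fun i => Pi.single i 1, ?_⟩
  ext t
  simp [affineSimplex_single, simplexRetraction_coe]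

theorem exists_eq_comp_seg (s : SingularSimplex Y 1) :
    ∃ (f : C(Fin 2 → ℝ, Y)) (p q : Fin 2 → ℝ), s = f.comp (seg p q) := by
  obtain ⟨f, v, rfl⟩ := exists_eq_comp_affineSimplex s
  exact ⟨f, v 0, v 1, by rw [seg]; congr 2; ext i; fin_cases i <;> rfl⟩

theorem cochain_ext {c d : Cochain Y 1}
    (h : ∀ (f : C(Fin 2 → ℝ, Y)) (p q : Fin 2 → ℝ), lineIntegral c f p q = lineIntegral d f p q) :
    c = d := by
  funext s
  obtain ⟨f, p, q, rfl⟩ := exists_eq_comp_seg s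
  exact h f p q

theorem isCocycle_of_lineIntegral_add {c : Cochain Y 1}
    (h : ∀ (f : C(Fin 3 → ℝ, Y)) (p q r : Fin 3 → ℝ),
      lineIntegral c f p q + lineIntegral c f q r = lineIntegral c f p r) : IsCocycle c := by
  funext s
  obtain ⟨f, v, rfl⟩ := exists_eq_comp_affineSimplex s
  rw [coboundary_comp_affineSimplex, Pi.zero_apply]
  linarith [h f (v 0) (v 1) (v 2)]

theorem isCocycle_coboundary (b : Cochain Y 0) : IsCocycle (coboundary Y 0 b) :=
  isCocycle_of_lineIntegral_add fun f p q r => by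
    simp only [lineIntegral_coboundary]
    ring

end SimplexRetraction

/-! ### Primitives of singular cocycles -/

section Radial

variable {V : Type*} [NormedAddCommGroup V] [NormedSpace ℝ V]

/-- The radial retraction onto the closed ball of radius `r` around `p`. -/
def ballRetraction (p : V) {r : ℝ} (hr : 0 < r) : C(V, V) where
  toFun x := p + (r / max r ‖x - p‖) • (x - p)
  continuous_toFun := continuous_const.add <|
    (Continuous.div (by fun_prop) (by fun_prop) fun _ => (lt_max_of_lt_left hr).ne').smul
      (by fun_prop)

theorem ballRetraction_apply (p : V) {r : ℝ} (hr : 0 < r) (x : V) :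
    ballRetraction p hr x = p + (r / max r ‖x - p‖) • (x - p) := rfl

theorem ballRetraction_mem (p : V) {r : ℝ} (hr : 0 < r) (x : V) :
    ballRetraction p hr x ∈ closedBall p r := by
  have h : 0 < max r ‖x - p‖ := lt_max_of_lt_left hr
  rw [mem_closedBall, dist_eq_norm, ballRetraction_apply, add_sub_cancel_left, norm_smul,
    Real.norm_of_nonneg (by positivity), div_mul_eq_mul_div, div_le_iff₀ h]
  gcongr
  exact le_max_right _ _

theorem ballRetraction_eq_self {p : V} {r : ℝ} (hr : 0 < r) {x : V} (hx : x ∈ closedBall p r) :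
    ballRetraction p hr x = x := by
  rw [mem_closedBall, dist_eq_norm] at hx
  rw [ballRetraction_apply, max_eq_left hx, div_self hr.ne', one_smul, add_sub_cancel]

end Radial

section Primitive

variable {Y : Type u} [TopologicalSpace Y] {φ ψ : Y → ℝ} {c d : Cochain Y 1}

/-- The function `φ` is, up to sign and a continuous function, a primitive of the `1`-cochain `c`
along the map `f` from a real vector space. -/
def IsPrimitiveAlong {V : Type*} [AddCommGroup V] [Module ℝ V] [TopologicalSpace V]
    [IsTopologicalAddGroup V] [ContinuousSMul ℝ V] (φ : Y → ℝ) (c : Cochain Y 1) (f : C(V, Y)) :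
    Prop :=
  ∀ p, Continuous fun x => φ (f x) + lineIntegral c f p x

/-- The function `φ` is, up to sign and continuous functions, a primitive of the `1`-cochain `c`
along every map from a finite-dimensional real vector space. -/
def IsPrimitive (φ : Y → ℝ) (c : Cochain Y 1) : Prop :=
  ∀ (m : ℕ) (f : C(Fin m → ℝ, Y)), IsPrimitiveAlong φ c f

namespace IsPrimitiveAlong

section

variable {V : Type*} [AddCommGroup V] [Module ℝ V] [TopologicalSpace V] [IsTopologicalAddGroup V]
  [ContinuousSMul ℝ V]

theorem of_continuous (hc : IsCocycle c) {f : C(V, Y)} {p : V}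
    (h : Continuous fun x => φ (f x) + lineIntegral c f p x) : IsPrimitiveAlong φ c f := by
  intro q
  convert h.fun_sub (continuous_const (y := (lineIntegral c f p q : ℝ))) using 2 with x
  rw [← hc.lineIntegral_add f p q x]
  push_cast
  ring

theorem congr {f : C(V, Y)} (h : IsPrimitiveAlong φ c f) (hψ : ∀ x, ψ (f x) = φ (f x)) :
    IsPrimitiveAlong ψ c f := by
  intro p
  simpa only [hψ] using h p

theorem comp (hc : IsCocycle c) {W : Type*} [AddCommGroup W] [Module ℝ W] [TopologicalSpace W]
    [IsTopologicalAddGroup W] [ContinuousSMul ℝ W] {f : C(V, Y)} (h : IsPrimitiveAlong φ c f)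
    (w : C(W, V)) : IsPrimitiveAlong φ c (f.comp w) := by
  intro p
  simpa only [Function.comp_def, hc.lineIntegral_comp] using! (h (w p)).comp w.continuous

theorem of_homotopy (hc : IsCocycle c) (F : C(V × ℝ, Y)) {f g : C(V, Y)}
    (hf : ∀ x, F (x, 0) = f x) (hg : ∀ x, F (x, 1) = g x) (h : IsPrimitiveAlong ψ c g)
    (hF : Continuous fun x => φ (f x) - ψ (g x) - lineIntegral c F (x, 0) (x, 1)) :
    IsPrimitiveAlong φ c f := by
  intro p
  have along_f (x : V) : lineIntegral c f p x = lineIntegral c F (p, 0) (x, 0) :=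
    lineIntegral_eq_of_forall c fun s => by simp [← hf, seg_apply_eq_add_smul]
  have along_g (x : V) : lineIntegral c g p x = lineIntegral c F (p, 1) (x, 1) :=
    lineIntegral_eq_of_forall c fun s => by simp [← hg, seg_apply_eq_add_smul]
  convert ((h p).fun_add hF).fun_add (continuous_const (y := (lineIntegral c F (p, 0) (p, 1) : ℝ)))
    using 2 with x
  have square : (lineIntegral c f p x : ℝ) + lineIntegral c F (x, 0) (x, 1) =
      lineIntegral c F (p, 0) (p, 1) + lineIntegral c g p x := by
    rw [along_f, along_g]
    exact_mod_cast (hc.lineIntegral_add F _ _ _).trans (hc.lineIntegral_add F _ _ _).symm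
  linarith

end

theorem of_ballRetraction {V : Type*} [NormedAddCommGroup V] [NormedSpace ℝ V] (hc : IsCocycle c)
    {f : C(V, Y)}
    (h : ∀ p, ∃ r, ∃ hr : 0 < r, IsPrimitiveAlong φ c (f.comp (ballRetraction p hr))) :
    IsPrimitiveAlong φ c f := by
  refine of_continuous hc (p := 0) (continuous_iff_continuousAt.2 fun p => ?_)
  obtain ⟨r, hr, hp⟩ := h p
  refine ((hp p).fun_sub (continuous_const (y := (lineIntegral c f p 0 : ℝ)))).continuousAt.congr ?_
  filter_upwards [closedBall_mem_nhds p hr] with x hx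
  have same_integral : lineIntegral c (f.comp (ballRetraction p hr)) p x = lineIntegral c f p x :=
    lineIntegral_congr c (convex_closedBall p r)
      (fun z hz => by rw [ContinuousMap.comp_apply, ballRetraction_eq_self hr hz])
      (mem_closedBall_self hr.le) hx
  rw [same_integral, ContinuousMap.comp_apply, ballRetraction_eq_self hr hx,
    ← hc.lineIntegral_add f p 0 x]
  push_cast
  ring

end IsPrimitiveAlong

namespace IsPrimitive

theorem of_continuous (h : Continuous φ) : IsPrimitive φ 0 := by
  intro m f p
  simpa [lineIntegral, Function.comp_def] using h.comp f.continuous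

theorem add (h : IsPrimitive φ c) (h' : IsPrimitive ψ d) : IsPrimitive (φ + ψ) (c + d) := by
  intro m f p
  convert (h m f p).fun_add (h' m f p) using 2 with x
  simp only [lineIntegral, Pi.add_apply, Int.cast_add]
  ring

theorem zsmul (h : IsPrimitive φ c) (n : ℤ) : IsPrimitive (n • φ) (n • c) := by
  intro m f p
  convert (continuous_const (y := (n : ℝ))).fun_mul (h m f p) using 2 with x
  simp [lineIntegral, mul_add]

theorem midpoint (h : IsPrimitive φ c) (h' : IsPrimitive ψ c) :
    IsPrimitive (fun y => (φ y + ψ y) / 2) c := by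
  intro m f p
  convert ((h m f p).fun_add (h' m f p)).div_const 2 using 2 with x
  ring

theorem pullback (h : IsPrimitive φ c) {Z : Type v} [TopologicalSpace Z] (g : C(Z, Y)) :
    IsPrimitive (φ ∘ g) (pullback g 1 c) := fun m f => h m (g.comp f)

theorem coboundary (b : Cochain Y 0) :
    IsPrimitive (fun y => (b (.const _ y) : ℝ)) (-coboundary Y 0 b) := by
  intro m f p
  have integral (x : Fin m → ℝ) :
      lineIntegral (-EquivCoh.coboundary Y 0 b) f p x = b (.const _ (f p)) - b (.const _ (f x)) :=
    (congrArg Neg.neg (lineIntegral_coboundary b f p x)).trans (neg_sub _ _)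
  simpa [integral] using continuous_const

theorem unique (hc : IsCocycle c) (hd : IsCocycle d) (h : IsPrimitive φ c)
    (h' : IsPrimitive φ d) : c = d := by
  refine cochain_ext fun f p q => ?_
  have continuous_sub : Continuous fun x => lineIntegral c f p x - lineIntegral d f p x := by
    rw [Int.isClosedEmbedding_coe_real.continuous_iff]
    convert (h 2 f p).fun_sub (h' 2 f p) using 2 with x
    simp
  have const := PreconnectedSpace.constant inferInstance continuous_sub (x := q) (y := p)
  rw [hc.lineIntegral_self, hd.lineIntegral_self] at const
  linarith

end IsPrimitive

end Primitive

/-! ### Maps defined cell by cell -/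

section CW

open RelCWComplex

variable {X : Type u} [TopologicalSpace X] [CWComplex (univ : Set X)]

/-- The characteristic map of a cell, extended to the whole vector space by the radial retraction
onto the closed unit ball. -/
def charMap (n : ℕ) (i : cell (univ : Set X) n) : C(Fin n → ℝ, X) where
  toFun y := map n i (ballRetraction 0 one_pos y)
  continuous_toFun := (continuousOn n i).comp_continuous (map_continuous _)
    fun y => ballRetraction_mem _ _ y

section CharMap

variable {n : ℕ} (i : cell (univ : Set X) n)

theorem charMap_ballRetraction (y : Fin n → ℝ) :
    charMap n i (ballRetraction 0 one_pos y) = charMap n i y :=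
  congrArg (map n i) (ballRetraction_eq_self one_pos (ballRetraction_mem _ _ y))

theorem charMap_eq_map {y : Fin n → ℝ} (hy : y ∈ closedBall (0 : Fin n → ℝ) 1) :
    charMap n i y = map n i y :=
  congrArg (map n i) (ballRetraction_eq_self one_pos hy)

theorem charMap_image_closedBall : charMap n i '' closedBall 0 1 = closedCell n i :=
  image_congr fun _ => charMap_eq_map i

theorem charMap_image_ball : charMap n i '' ball 0 1 = openCell n i :=
  image_congr fun _ hy => charMap_eq_map i (ball_subset_closedBall hy)

theorem charMap_image_sphere : charMap n i '' sphere 0 1 = cellFrontier n i :=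
  image_congr fun _ hy => charMap_eq_map i (sphere_subset_closedBall hy)

theorem charMap_mem_closedCell (y : Fin n → ℝ) : charMap n i y ∈ closedCell n i :=
  ⟨_, ballRetraction_mem _ _ y, rfl⟩

theorem charMap_smul_of_norm_eq_one {y : Fin n → ℝ} (hy : ‖y‖ = 1) {r : ℝ} (hr : 1 ≤ r) :
    charMap n i (r • y) = charMap n i y := by
  have retract : ballRetraction 0 one_pos (r • y) = y := by
    have norm_eq : ‖r • y‖ = r := by rw [norm_smul, hy, mul_one, Real.norm_of_nonneg (by linarith)]
    rw [ballRetraction_apply, sub_zero, zero_add, norm_eq, max_eq_right hr, smul_smul,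
      one_div_mul_cancel (by linarith), one_smul]
  rw [← charMap_ballRetraction, retract]

theorem openCell_inj {j : cell (univ : Set X) n} {x : X} (hi : x ∈ openCell n i)
    (hj : x ∈ openCell n j) : i = j :=
  eq_of_heq (Sigma.mk.inj (eq_of_not_disjoint_openCell (not_disjoint_iff.2 ⟨x, hi, hj⟩))).2

theorem injOn_charMap_ball : InjOn (charMap n i) (ball 0 1) := by
  intro y hy z hz h
  rw [charMap_eq_map i (ball_subset_closedBall hy),
    charMap_eq_map i (ball_subset_closedBall hz)] at h
  exact (map n i).injOn (by rwa [source_eq]) (by rwa [source_eq]) h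

theorem exists_eq_comp_charMap {S : Type*} [TopologicalSpace S] {f : C(S, X)}
    (hf : ∀ s, f s ∈ openCell n i) : ∃ w : C(S, Fin n → ℝ), f = (charMap n i).comp w := by
  have target (s : S) : f s ∈ (map n i).target := by
    rw [← (map n i).image_source_eq_target, source_eq]
    exact hf s
  refine ⟨⟨fun s => (map n i).symm (f s),
    (continuousOn_symm n i).comp_continuous (map_continuous f) target⟩, ?_⟩
  ext s
  have source := (map n i).map_target (target s)
  rw [source_eq] at source
  exact ((charMap_eq_map i (ball_subset_closedBall source)).trans
    ((map n i).right_inv (target s))).symm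

theorem IsCocycle.lineIntegral_charMap_ballRetraction {c : Cochain X 1} (hc : IsCocycle c)
    (y : Fin n → ℝ) : lineIntegral c (charMap n i) 0 (ballRetraction 0 one_pos y) =
      lineIntegral c (charMap n i) 0 y := by
  have comp_eq : (charMap n i).comp (ballRetraction 0 one_pos) = charMap n i :=
    ContinuousMap.ext (charMap_ballRetraction i)
  have center : ballRetraction (0 : Fin n → ℝ) one_pos 0 = 0 :=
    ballRetraction_eq_self one_pos (mem_closedBall_self zero_le_one)
  have integral := hc.lineIntegral_comp (charMap n i) (ballRetraction 0 one_pos) 0 y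
  rw [comp_eq, center] at integral
  exact integral.symm

theorem IsCocycle.lineIntegral_charMap_two_smul {c : Cochain X 1} (hc : IsCocycle c)
    {y : Fin n → ℝ} (hy : ‖y‖ = 1) :
    lineIntegral c (charMap n i) 0 ((2 : ℝ) • y) = lineIntegral c (charMap n i) 0 y := by
  have along_ray : lineIntegral c (charMap n i) y ((2 : ℝ) • y) = 0 :=
    hc.lineIntegral_of_forall_eq (y := charMap n i y) fun s => by
      have point : seg y ((2 : ℝ) • y) s = (1 + s 1) • y := by
        rw [seg_apply_eq_add_smul]
        module
      rw [point]
      exact charMap_smul_of_norm_eq_one i hy (by linarith [stdSimplex.zero_le s 1])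
  rw [← hc.lineIntegral_add _ 0 y, along_ray, add_zero]

variable [T2Space X]

theorem charMap_mem_skeletonLT {y : Fin n → ℝ} (hy : 1 ≤ ‖y‖) :
    charMap n i y ∈ skeletonLT (univ : Set X) n := by
  have unit : ‖‖y‖⁻¹ • y‖ = 1 := norm_smul_inv_norm (𝕜 := ℝ) (norm_pos_iff.1 (by linarith))
  have smul : y = ‖y‖ • ‖y‖⁻¹ • y := (smul_inv_smul₀ (by linarith) y).symm
  rw [smul, charMap_smul_of_norm_eq_one i unit hy]
  exact cellFrontier_subset_skeletonLT n i
    (charMap_image_sphere i ▸ mem_image_of_mem _ (mem_sphere_zero_iff_norm.2 unit))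

end CharMap

variable [T2Space X]

theorem mem_skeletonLT_succ_iff {n : ℕ} {x : X} :
    x ∈ skeletonLT (univ : Set X) (n + 1) ↔
      x ∈ skeletonLT (univ : Set X) n ∨ ∃ i : cell (univ : Set X) n, x ∈ openCell n i := by
  rw [CWComplex.mem_skeletonLT_iff, CWComplex.mem_skeletonLT_iff]
  constructor
  · rintro ⟨m, hm, j, hj⟩
    rcases Nat.lt_succ_iff_lt_or_eq.1 (by exact_mod_cast hm : m < n + 1) with hm | rfl
    · exact .inl ⟨m, by exact_mod_cast hm, j, hj⟩
    · exact .inr ⟨j, hj⟩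
  · rintro (⟨m, hm, j, hj⟩ | ⟨i, hi⟩)
    · exact ⟨m, hm.trans_le le_self_add, j, hj⟩
    · exact ⟨n, by exact_mod_cast n.lt_succ_self, i, hi⟩

theorem closedCell_subset_skeletonLT_of_lt {m : ℕ} {n : ℕ∞} (hm : m < n)
    (i : cell (univ : Set X) m) : closedCell m i ⊆ skeletonLT (univ : Set X) n :=
  (closedCell_subset_skeletonLT m i).trans (skeletonLT_mono (Order.add_one_le_of_lt hm))

theorem continuousOn_skeletonLT {Z : Type*} [TopologicalSpace Z] {n : ℕ∞} {h : X → Z}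
    (hh : ∀ m : ℕ, m < n → ∀ i : cell (univ : Set X) m, Continuous (h ∘ charMap m i)) :
    ContinuousOn h (skeletonLT (univ : Set X) n) := by
  refine continuousOn_iff_isClosed.2 fun F hF =>
    ⟨h ⁻¹' F ∩ skeletonLT (univ : Set X) n, ?_, by rw [inter_assoc, inter_self]⟩
  refine CWComplex.isClosed_of_disjoint_openCell_or_isClosed_inter_closedCell (subset_univ _)
    fun m _ i => ?_
  rcases le_or_gt n m with hm | hm
  · exact .inl ((disjoint_skeletonLT_openCell hm).mono_left inter_subset_right)
  · have image : h ⁻¹' F ∩ skeletonLT (univ : Set X) n ∩ closedCell m i =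
        charMap m i '' (closedBall 0 1 ∩ (h ∘ charMap m i) ⁻¹' F) := by
      rw [inter_assoc, inter_eq_right.2 (closedCell_subset_skeletonLT_of_lt hm i), preimage_comp,
        image_inter_preimage, charMap_image_closedBall, inter_comm]
    rw [image]
    exact .inr (((isCompact_closedBall _ _).inter_right (hF.preimage (hh m hm i))).image
      (map_continuous _)).isClosed

theorem continuous_of_continuous_comp_charMap {Z : Type*} [TopologicalSpace Z] {h : X → Z}
    (hh : ∀ n (i : cell (univ : Set X) n), Continuous (h ∘ charMap n i)) : Continuous h := by
  rw [← continuousOn_univ, ← skeletonLT_top (C := (univ : Set X))]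
  exact continuousOn_skeletonLT fun n _ => hh n

theorem exists_natCast_skeletonLT (x : X) : ∃ n : ℕ, x ∈ skeletonLT (univ : Set X) n := by
  have cover := iUnion_skeletonLT_eq_complex (C := (univ : Set X))
  exact mem_iUnion.1 (cover.ge (mem_univ x))

variable (X) in
theorem deltaGeneratedSpace_of_cwComplex : DeltaGeneratedSpace X :=
  ⟨continuous_of_continuous_comp_charMap fun _ i =>
    (IsGeneratedBy.equiv_symm_comp_continuous_iff _ _).2 (map_continuous (charMap _ i))⟩

/-- Points `x n` of a compact set outside the `n`-skeleta would form a set all of whose tails are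
closed, since a cell contains only finitely many of them. -/
theorem exists_subset_skeletonLT {K : Set X} (hK : IsCompact K) :
    ∃ n : ℕ, K ⊆ skeletonLT (univ : Set X) n := by
  by_contra! h
  choose x hxK hx using fun n => not_subset.1 (h n)
  have isClosed_tail (m : ℕ) : IsClosed (x '' Ici m) := by
    rw [CWComplex.closed univ _ (subset_univ _)]
    intro n j
    refine (((finite_Iic n).image x).subset ?_).isClosed
    rintro _ ⟨⟨k, -, rfl⟩, hk⟩
    refine mem_image_of_mem x (mem_Iic.2 (le_of_not_gt fun hnk => hx k ?_))
    exact skeletonLT_mono (by exact_mod_cast hnk) (closedCell_subset_skeletonLT n j hk)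
  obtain ⟨y, -, hy⟩ : (K ∩ ⋂ m, x '' Ici m).Nonempty := by
    by_contra! empty
    obtain ⟨m, hm⟩ := hK.elim_directed_family_closed _ isClosed_tail empty
      (Antitone.directed_ge fun _ _ h => image_mono (Ici_subset_Ici.2 h))
    exact eq_empty_iff_forall_notMem.1 hm (x m) ⟨hxK m, mem_image_of_mem x self_mem_Ici⟩
  obtain ⟨m, hm⟩ := exists_natCast_skeletonLT y
  obtain ⟨k, hk, rfl⟩ := mem_iInter.1 hy m
  exact hx k (skeletonLT_mono (by exact_mod_cast hk) hm)

theorem exists_eqOn_skeletonLT_of_sphere {Z : Type*} {n : ℕ} (h : X → Z)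
    (g : cell (univ : Set X) n → (Fin n → ℝ) → Z)
    (hg : ∀ i, ∀ y ∈ sphere (0 : Fin n → ℝ) 1, g i y = h (charMap n i y)) :
    ∃ h' : X → Z, EqOn h' h (skeletonLT (univ : Set X) n) ∧
      ∀ i, ∀ y ∈ closedBall (0 : Fin n → ℝ) 1, h' (charMap n i y) = g i y := by
  classical
  let h' (x : X) : Z := if hx : ∃ z : Σ _ : cell (univ : Set X) n, Fin n → ℝ,
    z.2 ∈ ball 0 1 ∧ charMap n z.1 z.2 = x then g hx.choose.1 hx.choose.2 else h x
  have lower : EqOn h' h (skeletonLT (univ : Set X) n) := by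
    refine fun x hx => dif_neg ?_
    rintro ⟨⟨i, y⟩, hy, rfl⟩
    exact disjoint_left.1 (disjoint_skeletonLT_openCell le_rfl) hx
      (charMap_image_ball i ▸ mem_image_of_mem _ hy)
  refine ⟨h', lower, fun i y hy => ?_⟩
  rcases (ball_union_sphere (x := (0 : Fin n → ℝ)) (ε := 1)).ge hy with hy | hy
  · have hx : ∃ z : Σ _ : cell (univ : Set X) n, Fin n → ℝ,
      z.2 ∈ ball 0 1 ∧ charMap n z.1 z.2 = charMap n i y := ⟨⟨i, y⟩, hy, rfl⟩
    have choose_fst : hx.choose.1 = i := by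
      refine openCell_inj (x := charMap n i y) _ ?_ ?_ <;> rw [← charMap_image_ball]
      exacts [⟨_, hx.choose_spec⟩, mem_image_of_mem _ hy]
    refine (dif_pos hx).trans ?_
    obtain ⟨mem, eq⟩ := hx.choose_spec
    generalize hx.choose = z at choose_fst mem eq
    obtain ⟨_, z⟩ := z
    subst choose_fst
    exact congrArg (g _) (injOn_charMap_ball _ mem hy eq)
  · rw [hg i y hy]
    exact lower (charMap_mem_skeletonLT i (mem_sphere_zero_iff_norm.1 hy).ge)

theorem exists_continuousOn_skeletonLT_succ {Z : Type*} [TopologicalSpace Z] {n : ℕ} (h : C(X, Z))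
    (g : cell (univ : Set X) n → C(Fin n → ℝ, Z))
    (hg : ∀ i, ∀ y ∈ sphere (0 : Fin n → ℝ) 1, g i y = h (charMap n i y)) :
    ∃ h' : X → Z, ContinuousOn h' (skeletonLT (univ : Set X) (n + 1)) ∧
      EqOn h' h (skeletonLT (univ : Set X) n) ∧
      ∀ i, ∀ y ∈ closedBall (0 : Fin n → ℝ) 1, h' (charMap n i y) = g i y := by
  obtain ⟨h', lower, top⟩ := exists_eqOn_skeletonLT_of_sphere h (fun i => g i) hg
  refine ⟨h', continuousOn_skeletonLT fun m hm i => ?_, lower, top⟩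
  rcases Nat.lt_succ_iff_lt_or_eq.1 (by exact_mod_cast hm : m < n + 1) with hm | rfl
  · have factors : h' ∘ charMap m i = h.comp (charMap m i) := funext fun y =>
      lower (closedCell_subset_skeletonLT_of_lt (by exact_mod_cast hm) i
        (charMap_mem_closedCell i y))
    exact factors ▸ map_continuous _
  · have factors : h' ∘ charMap m i = (g i).comp (ballRetraction 0 one_pos) := by
      funext y
      rw [Function.comp_apply, ← charMap_ballRetraction, top i _ (ballRetraction_mem _ _ y)]
      rfl
    exact factors ▸ map_continuous _

end CW

/-! ### Existence of primitives on CW complexes -/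

section CWPrimitive

open RelCWComplex

variable {X : Type u} [TopologicalSpace X] [T2Space X] [CWComplex (univ : Set X)]

theorem isOpen_preimage_openCell {S : Type*} [TopologicalSpace S] {n : ℕ} {f : C(S, X)}
    (hf : ∀ s, f s ∈ skeletonLT (univ : Set X) (n + 1)) (i : cell (univ : Set X) n) :
    IsOpen (f ⁻¹' openCell n i) := by
  classical
  obtain ⟨N, continuousOn_N, lower, top⟩ := exists_continuousOn_skeletonLT_succ (n := n)
    (.const X (1 : ℝ)) (fun j => if j = i then ⟨norm, continuous_norm⟩ else .const _ 1)
    fun j y hy => by split_ifs <;> simp [mem_sphere_zero_iff_norm.1 hy]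
  have preimage : f ⁻¹' openCell n i = (N ∘ f) ⁻¹' Iio 1 := by
    ext s
    rcases mem_skeletonLT_succ_iff.1 (hf s) with hs | ⟨j, hj⟩
    · have notMem : f s ∉ openCell n i := disjoint_left.1 (disjoint_skeletonLT_openCell le_rfl) hs
      simp [notMem, lower hs]
    · obtain ⟨y, hy, hys⟩ := (charMap_image_ball j).ge hj
      have value := top j y (ball_subset_closedBall hy)
      rw [hys] at value
      by_cases hji : j = i
      · subst hji
        simpa [hj, value] using hy
      · have notMem : f s ∉ openCell n i := fun hi => hji (openCell_inj j hj hi)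
        simp [notMem, value, hji]
  rw [preimage]
  exact isOpen_Iio.preimage (continuousOn_N.comp_continuous (map_continuous f) hf)

theorem exists_cellExpansion (n : ℕ) :
    ∃ H : X → C(ℝ, X), ContinuousOn H (skeletonLT (univ : Set X) (n + 1)) ∧
      (∀ x ∈ skeletonLT (univ : Set X) n, H x = .const ℝ x) ∧
      ∀ (i : cell (univ : Set X) n), ∀ y ∈ closedBall (0 : Fin n → ℝ) 1, ∀ t,
        H (charMap n i y) t = charMap n i ((1 + |t|) • y) := by
  obtain ⟨H, continuousOn_H, lower, top⟩ := exists_continuousOn_skeletonLT_succ (n := n)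
    (ContinuousMap.const' : C(X, C(ℝ, X))) (fun i => ContinuousMap.curry
      ((charMap n i).comp ⟨fun z : (Fin n → ℝ) × ℝ => (1 + |z.2|) • z.1, by fun_prop⟩))
    fun i y hy => ContinuousMap.ext fun t => charMap_smul_of_norm_eq_one i
      (mem_sphere_zero_iff_norm.1 hy) (by linarith [abs_nonneg t])
  exact ⟨H, continuousOn_H, fun x hx => lower hx, fun i y hy t => by rw [top i y hy]; rfl⟩

theorem exists_cellNorm (n : ℕ) :
    ∃ N : X → ℝ, ContinuousOn N (skeletonLT (univ : Set X) (n + 1)) ∧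
      EqOn N 1 (skeletonLT (univ : Set X) n) ∧
      ∀ (i : cell (univ : Set X) n), ∀ y ∈ closedBall (0 : Fin n → ℝ) 1,
        N (charMap n i y) = ‖y‖ :=
  exists_continuousOn_skeletonLT_succ (.const X 1) (fun _ => ⟨norm, continuous_norm⟩)
    fun _ _ hy => mem_sphere_zero_iff_norm.1 hy

variable {c : Cochain X 1} (hc : IsCocycle c) {φ : X → ℝ}
include hc

theorem continuousOn_sub_cellExpansion {n : ℕ}
    (hφ : ∀ i : cell (univ : Set X) n, IsPrimitiveAlong φ c (charMap n i)) {H : X → C(ℝ, X)}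
    (lower : ∀ x ∈ skeletonLT (univ : Set X) n, H x = .const ℝ x)
    (top : ∀ (i : cell (univ : Set X) n), ∀ y ∈ closedBall (0 : Fin n → ℝ) 1, ∀ t,
      H (charMap n i y) t = charMap n i ((1 + |t|) • y)) :
    ContinuousOn (fun x => φ x - φ (H x 1) - lineIntegral c (H x) 0 1)
      (skeletonLT (univ : Set X) (n + 1)) := by
  refine continuousOn_skeletonLT fun m hm i => ?_
  rcases Nat.lt_succ_iff_lt_or_eq.1 (by exact_mod_cast hm : m < n + 1) with hm | rfl
  · refine continuous_const (y := (0 : ℝ)).congr fun y => ?_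
    have fixed := lower _ (closedCell_subset_skeletonLT_of_lt (by exact_mod_cast hm) i
      (charMap_mem_closedCell i y))
    have integral : lineIntegral c (.const ℝ (charMap m i y)) 0 1 = 0 :=
      hc.lineIntegral_of_forall_eq fun _ => rfl
    simp [fixed, integral]
  · let Θ (y : Fin m → ℝ) : ℝ := φ (charMap m i y) + lineIntegral c (charMap m i) 0 y
    have continuous_Θ : Continuous Θ := hφ i 0
    refine (((continuous_Θ.sub (continuous_Θ.comp (continuous_const_smul (2 : ℝ)))).comp
      (ballRetraction 0 one_pos).continuous)).congr fun y => ?_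
    have hy := ballRetraction_mem 0 one_pos y
    rw [Function.comp_apply, Function.comp_apply, ← charMap_ballRetraction i y]
    generalize ballRetraction 0 one_pos y = z at hy
    have path : H (charMap m i z) = (charMap m i).comp ⟨fun t : ℝ => (1 + |t|) • z, by fun_prop⟩ :=
      ContinuousMap.ext (top i z hy)
    have integral : lineIntegral c (H (charMap m i z)) 0 1 =
        lineIntegral c (charMap m i) z ((2 : ℝ) • z) := by
      rw [path, hc.lineIntegral_comp]
      norm_num
    have split := hc.lineIntegral_add (charMap m i) 0 z ((2 : ℝ) • z)
    have two : (1 + |1| : ℝ) = 2 := by norm_num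
    simp only [Pi.sub_apply, Function.comp_apply, Θ, integral, top i z hy, two, ← split,
      Int.cast_add]
    ring

variable {V : Type*} [NormedAddCommGroup V] [NormedSpace ℝ V]

theorem isPrimitiveAlong_of_lt_cellNorm {n : ℕ}
    (hφ : ∀ i : cell (univ : Set X) n, IsPrimitiveAlong φ c (charMap n i))
    (ih : ∀ g : C(V, X), (∀ v, g v ∈ skeletonLT (univ : Set X) n) → IsPrimitiveAlong φ c g)
    {N : X → ℝ}
    (hN : ∀ (i : cell (univ : Set X) n), ∀ y ∈ closedBall (0 : Fin n → ℝ) 1,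
      N (charMap n i y) = ‖y‖) {f : C(V, X)}
    (hf : ∀ v, f v ∈ skeletonLT (univ : Set X) (n + 1)) (hNf : ∀ v, 1 / 2 < N (f v)) :
    IsPrimitiveAlong φ c f := by
  obtain ⟨H, continuousOn_H, lower, top⟩ := exists_cellExpansion (X := X) n
  let F : C(V × ℝ, X) := ContinuousMap.uncurry
    ⟨fun v => H (f v), continuousOn_H.comp_continuous (map_continuous f) hf⟩
  let g : C(V, X) := F.comp ⟨fun v => (v, 1), by fun_prop⟩
  have start (v : V) : F (v, 0) = f v := by
    change H (f v) 0 = f v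
    rcases mem_skeletonLT_succ_iff.1 (hf v) with hv | ⟨i, hi⟩
    · rw [lower _ hv, ContinuousMap.const_apply]
    · obtain ⟨y, hy, hyv⟩ := (charMap_image_ball i).ge hi
      simp [← hyv, top i y (ball_subset_closedBall hy)]
  have finish (v : V) : g v ∈ skeletonLT (univ : Set X) n := by
    change H (f v) 1 ∈ _
    rcases mem_skeletonLT_succ_iff.1 (hf v) with hv | ⟨i, hi⟩
    · rwa [lower _ hv, ContinuousMap.const_apply]
    · obtain ⟨y, hy, hyv⟩ := (charMap_image_ball i).ge hi
      have norm_gt := hNf v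
      rw [← hyv, hN i y (ball_subset_closedBall hy)] at norm_gt
      rw [← hyv, top i y (ball_subset_closedBall hy)]
      refine charMap_mem_skeletonLT i ?_
      norm_num [norm_smul]
      linarith
  refine .of_homotopy hc F start (fun _ => rfl) (ih g finish) ?_
  refine ((continuousOn_sub_cellExpansion hc hφ lower top).comp_continuous (map_continuous f)
    hf).congr fun v => ?_
  have integral : lineIntegral c (H (f v)) 0 1 = lineIntegral c F (v, 0) (v, 1) :=
    lineIntegral_eq_of_forall c fun s => by simp [F, seg_apply_eq_add_smul]
  simp only [Function.comp_apply, integral]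
  rfl

/-- A map that stays inside an open cell factors through its characteristic map, and one that
avoids the centres of the top-dimensional cells can be pushed off these cells. -/
theorem isPrimitiveAlong_of_mem_skeletonLT {n : ℕ}
    (hφ : ∀ m < n, ∀ i : cell (univ : Set X) m, IsPrimitiveAlong φ c (charMap m i)) (f : C(V, X))
    (hf : ∀ v, f v ∈ skeletonLT (univ : Set X) n) : IsPrimitiveAlong φ c f := by
  induction n generalizing f with
  | zero => exact absurd (CWComplex.skeletonLT_zero_eq_empty.le (hf 0)) (notMem_empty _)
  | succ n ih =>
    push_cast at hf
    obtain ⟨N, continuousOn_N, lower, top⟩ := exists_cellNorm (X := X) n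
    have localize {U : Set V} (hU : IsOpen U) {p : V} (hp : p ∈ U) :
        ∃ r, ∃ hr : 0 < r, ∀ v, ballRetraction p hr v ∈ U := by
      obtain ⟨r, hr, subset⟩ := nhds_basis_closedBall.mem_iff.1 (hU.mem_nhds hp)
      exact ⟨r, hr, fun v => subset (ballRetraction_mem p hr v)⟩
    refine .of_ballRetraction hc fun p => ?_
    rcases mem_skeletonLT_succ_iff.1 (hf p) with hp | ⟨i, hi⟩
    · obtain ⟨r, hr, hU⟩ := localize (U := (N ∘ f) ⁻¹' Ioi (1 / 2)) (p := p)
        (isOpen_Ioi.preimage (continuousOn_N.comp_continuous (map_continuous f) hf))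
        (by norm_num [lower hp])
      exact ⟨r, hr, isPrimitiveAlong_of_lt_cellNorm hc (hφ n n.lt_succ_self)
        (ih fun m hm => hφ m (hm.trans n.lt_succ_self)) top (fun v => hf _) hU⟩
    · obtain ⟨r, hr, hU⟩ := localize (isOpen_preimage_openCell hf i) hi
      obtain ⟨w, hw⟩ := exists_eq_comp_charMap i (f := f.comp (ballRetraction p hr)) hU
      exact ⟨r, hr, hw ▸ (hφ n n.lt_succ_self i).comp hc w⟩

theorem isPrimitive_of_isPrimitiveAlong_charMap
    (hφ : ∀ n (i : cell (univ : Set X) n), IsPrimitiveAlong φ c (charMap n i)) :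
    IsPrimitive φ c := fun _ f => .of_ballRetraction hc fun p => by
  obtain ⟨n, hn⟩ := exists_subset_skeletonLT ((isCompact_closedBall p 1).image f.continuous)
  exact ⟨1, one_pos, isPrimitiveAlong_of_mem_skeletonLT hc (fun m _ => hφ m) _
    fun v => hn (mem_image_of_mem f (ballRetraction_mem p one_pos v))⟩

/-- Near a point `p` of the sphere, the integrals can be computed after composing with
`y ↦ 2 y`, which maps a neighbourhood of `p` to the region where `charMap n i` is constant along
rays and takes values in the lower skeleton. -/
theorem continuousOn_sphere_integral_charMap {n : ℕ}
    (hφ : ∀ m < n, ∀ i : cell (univ : Set X) m, IsPrimitiveAlong φ c (charMap m i))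
    (i : cell (univ : Set X) n) :
    ContinuousOn (fun y => φ (charMap n i y) + lineIntegral c (charMap n i) 0 y)
      (sphere 0 1) := by
  intro p hp
  rw [mem_sphere_zero_iff_norm] at hp
  let w : C(Fin n → ℝ, Fin n → ℝ) :=
    ⟨fun y => (2 : ℝ) • ballRetraction p one_half_pos y, by fun_prop⟩
  have lower (y) : charMap n i (w y) ∈ skeletonLT (univ : Set X) n := by
    refine charMap_mem_skeletonLT i ?_
    have close := mem_closedBall'.1 (ballRetraction_mem p one_half_pos y)
    rw [dist_eq_norm] at close
    have := norm_sub_norm_le p (ballRetraction p one_half_pos y)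
    simp only [w, ContinuousMap.coe_mk, norm_smul, Real.norm_ofNat]
    linarith
  have primitive := isPrimitiveAlong_of_mem_skeletonLT hc hφ ((charMap n i).comp w) lower p
  simp only [ContinuousMap.comp_apply, hc.lineIntegral_comp] at primitive
  have value {y : Fin n → ℝ} (hy : ‖y‖ = 1) (hyp : y ∈ closedBall p (1 / 2)) :
      φ (charMap n i y) + lineIntegral c (charMap n i) 0 y =
        φ (charMap n i (w y)) + lineIntegral c (charMap n i) (w p) (w y) +
          lineIntegral c (charMap n i) 0 (w p) := by
    have wy : w y = (2 : ℝ) • y :=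
      congrArg (HSMul.hSMul (2 : ℝ)) (ballRetraction_eq_self one_half_pos hyp)
    have split : lineIntegral c (charMap n i) 0 (w p) + lineIntegral c (charMap n i) (w p) (w y) =
        lineIntegral c (charMap n i) 0 y := by
      rw [hc.lineIntegral_add, wy, hc.lineIntegral_charMap_two_smul i hy]
    rw [wy, charMap_smul_of_norm_eq_one i hy one_le_two, ← wy, ← split]
    push_cast
    ring
  refine (primitive.fun_add continuous_const).continuousWithinAt.congr_of_eventuallyEq ?_
    (value hp (mem_closedBall_self (by norm_num)))
  filter_upwards [self_mem_nhdsWithin,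
    mem_nhdsWithin_of_mem_nhds (closedBall_mem_nhds p one_half_pos)] with y hy hyp
  exact value (mem_sphere_zero_iff_norm.1 hy) hyp

theorem exists_isPrimitiveAlong_charMap_succ {n : ℕ}
    (hφ : ∀ m < n, ∀ i : cell (univ : Set X) m, IsPrimitiveAlong φ c (charMap m i)) :
    ∃ φ' : X → ℝ, EqOn φ' φ (skeletonLT (univ : Set X) n) ∧
      ∀ m < n + 1, ∀ i : cell (univ : Set X) m, IsPrimitiveAlong φ' c (charMap m i) := by
  choose T hT using fun i => ContinuousMap.exists_restrict_eq isClosed_sphere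
    ⟨_, (continuousOn_sphere_integral_charMap hc hφ i).domRestrict⟩
  obtain ⟨φ', lower, top⟩ := exists_eqOn_skeletonLT_of_sphere φ
    (fun i y => T i y - lineIntegral c (charMap n i) 0 y) fun i y hy => by
      rw [sub_eq_iff_eq_add]
      exact DFunLike.congr_fun (hT i) ⟨y, hy⟩
  refine ⟨φ', lower, fun m hm i => ?_⟩
  rcases Nat.lt_succ_iff_lt_or_eq.1 hm with hm | rfl
  · exact (hφ m hm i).congr fun y => lower (closedCell_subset_skeletonLT_of_lt
      (by exact_mod_cast hm) i (charMap_mem_closedCell i y))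
  · refine .of_continuous hc (p := 0)
      (((T i).comp (ballRetraction 0 one_pos)).continuous.congr fun y => ?_)
    rw [← hc.lineIntegral_charMap_ballRetraction, ← charMap_ballRetraction i y,
      top i _ (ballRetraction_mem 0 one_pos y)]
    simp

theorem exists_isPrimitive : ∃ φ : X → ℝ, IsPrimitive φ c := by
  let P (n : ℕ) (φ : X → ℝ) : Prop :=
    ∀ m < n, ∀ i : cell (univ : Set X) m, IsPrimitiveAlong φ c (charMap m i)
  choose extend extend_eqOn extend_spec using fun (n : ℕ) (φ : X → ℝ) (hφ : P n φ) =>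
    exists_isPrimitiveAlong_charMap_succ hc hφ
  let Φ : ∀ n, {φ : X → ℝ // P n φ} := Nat.rec ⟨0, fun _ h => absurd h (Nat.not_lt_zero _)⟩
    fun n φ => ⟨extend n φ.1 φ.2, extend_spec n φ.1 φ.2⟩
  have stable {m n : ℕ} (hmn : m ≤ n) : EqOn (Φ n).1 (Φ m).1 (skeletonLT (univ : Set X) m) := by
    induction n, hmn using Nat.le_induction with
    | base => exact eqOn_refl _ _
    | succ n hmn ih =>
      exact ((extend_eqOn n _ (Φ n).2).mono (skeletonLT_mono (by exact_mod_cast hmn))).trans ih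
  choose level mem_level using exists_natCast_skeletonLT (X := X)
  have limit (n : ℕ) : EqOn (fun x => (Φ (level x)).1 x) (Φ n).1 (skeletonLT (univ : Set X) n) := by
    intro x hx
    rcases le_total n (level x) with h | h
    · exact stable h hx
    · exact (stable h (mem_level x)).symm
  refine ⟨fun x => (Φ (level x)).1 x, isPrimitive_of_isPrimitiveAlong_charMap hc fun n i =>
    ((Φ (n + 1)).2 n n.lt_succ_self i).congr fun y => limit (n + 1) ?_⟩
  exact closedCell_subset_skeletonLT_of_lt (by exact_mod_cast n.lt_succ_self) i
    (charMap_mem_closedCell i y)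

end CWPrimitive

/-! ### Lifts through covering maps -/

section Lifting

variable {A B S : Type*} [TopologicalSpace A] [TopologicalSpace B] [TopologicalSpace S] {π : A → B}

theorem exists_lift [SimplyConnectedSpace S] [LocallyPathConnectedSpace S] (hπ : IsCoveringMap π)
    (surj : Function.Surjective π) (f : C(S, B)) : ∃ g : C(S, A), ∀ s, π (g s) = f s := by
  obtain ⟨s₀⟩ := (inferInstance : Nonempty S)
  obtain ⟨a, ha⟩ := surj (f s₀)
  obtain ⟨g, ⟨-, hg⟩, -⟩ := hπ.existsUnique_continuousMap_lifts f s₀ a ha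
  exact ⟨g, congrFun hg⟩

theorem exists_lift_simplex {B : Type u} [TopologicalSpace B] {π : A → B} (hπ : IsCoveringMap π)
    (surj : Function.Surjective π) {n : ℕ} (s : SingularSimplex B n) :
    ∃ t : C(stdSimplex ℝ (Fin (n + 1)), A), ∀ x, π (t x) = s x := by
  obtain ⟨f, v, rfl⟩ := exists_eq_comp_affineSimplex s
  obtain ⟨g, hg⟩ := exists_lift hπ surj f
  exact ⟨g.comp (affineSimplex v), fun x => hg _⟩

theorem fourierChar_eq_one_iff {x : ℝ} : 𝐞 x = 1 ↔ ∃ n : ℤ, x = n := by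
  rw [Real.fourierChar_apply', Circle.exp_eq_one]
  simp [mul_comm (2 * Real.pi), Real.two_pi_pos.ne']

theorem fourierChar_intCast (n : ℤ) : 𝐞 (n : ℝ) = 1 := fourierChar_eq_one_iff.2 ⟨n, rfl⟩

theorem fourierChar_intCast_mul (n : ℤ) (x : ℝ) : 𝐞 (n * x) = 𝐞 x ^ n := by
  rw [← zsmul_eq_mul, AddChar.map_zsmul_eq_zpow]

theorem fourierChar_surjective : Function.Surjective 𝐞 :=
  Circle.exp_surjective.comp (mul_left_surjective₀ Real.two_pi_pos.ne')

theorem isCoveringMap_fourierChar : IsCoveringMap 𝐞 :=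
  Circle.isCoveringMap_exp.comp_homeomorph (Homeomorph.mulLeft₀ _ Real.two_pi_pos.ne')

theorem sub_eq_sub_of_fourierChar_eq [PreconnectedSpace S] {f g : S → ℝ} (hf : Continuous f)
    (hg : Continuous g) (h : ∀ s, 𝐞 (f s) = 𝐞 (g s)) (s t : S) : f s - g s = f t - g t := by
  have trivial_difference (s : S) : 𝐞 (f s - g s) = 1 := by
    rw [AddChar.map_sub_eq_div, h, div_self']
  exact isCoveringMap_fourierChar.const_of_comp (hf.fun_sub hg)
    (fun s t => (trivial_difference s).trans (trivial_difference t).symm) s t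

end Lifting

/-! ### Maps to the circle and singular cocycles -/

section SignedCochains

variable {Y : Type u} [TopologicalSpace Y]

/-- The subcomplex of the singular cochains that an involution `σ` multiplies by the sign `ε`. -/
def signedCochains (σ : C(Y, Y)) (ε : ℤ) (n : ℕ) : AddSubgroup (Cochain Y n) :=
  (pullback σ n).eqLocus (ε • AddMonoidHom.id _)

theorem mem_signedCochains {σ : C(Y, Y)} {ε : ℤ} {n : ℕ} {c : Cochain Y n} :
    c ∈ signedCochains σ ε n ↔ pullback σ n c = ε • c := Iff.rfl

theorem antiInvariantCochains_eq (σ : C(Y, Y)) :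
    antiInvariantCochains σ = signedCochains σ (-1) := by
  funext n
  ext c
  rw [mem_signedCochains, neg_one_zsmul]
  exact funext_iff.symm

end SignedCochains

section Lift

variable {Y : Type u} [TopologicalSpace Y] {φ : Y → ℝ} {c : Cochain Y 1}

theorem IsPrimitive.continuous_comp (h : IsPrimitive φ 0) {m : ℕ} (f : C(Fin m → ℝ, Y)) :
    Continuous (φ ∘ f) := by
  simpa [lineIntegral, Function.comp_def] using h m f 0

theorem IsPrimitive.continuous [DeltaGeneratedSpace Y] (h : IsPrimitive φ 0) : Continuous φ :=
  (IsGeneratedBy.continuous_iff (fun n => Fin n → ℝ) φ).2 fun _ f => h.continuous_comp f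

theorem IsPrimitive.continuous_fourierChar [DeltaGeneratedSpace Y] (h : IsPrimitive φ c) :
    Continuous fun y => 𝐞 (φ y) := by
  refine (IsGeneratedBy.continuous_iff (fun n => Fin n → ℝ) _).2 fun m f => ?_
  convert Real.continuous_fourierChar.comp (h m f 0) using 1
  ext x
  simp [AddChar.map_add_eq_mul, fourierChar_intCast]

theorem exists_isPrimitive_of_lift {F : C(Y, Circle)} (hφ : ∀ y, 𝐞 (φ y) = F y) :
    ∃ c : Cochain Y 1, IsCocycle c ∧ IsPrimitive φ c := by
  let v (i : Fin 2) : stdSimplex ℝ (Fin 2) := stdSimplex.vertex i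
  choose t ht using fun s : SingularSimplex Y 1 =>
    exists_lift_simplex isCoveringMap_fourierChar fourierChar_surjective (F.comp s)
  have integral (s : SingularSimplex Y 1) :
      ∃ n : ℤ, t s (v 1) - t s (v 0) - (φ (s (v 1)) - φ (s (v 0))) = n := by
    refine fourierChar_eq_one_iff.1 ?_
    simp [AddChar.map_sub_eq_div, ht, hφ]
  choose c hc using integral
  have lineIntegral_eq {m : ℕ} (f : C(Fin m → ℝ, Y)) {g : C(Fin m → ℝ, ℝ)}
      (hg : ∀ x, 𝐞 (g x) = F (f x)) (p q : Fin m → ℝ) :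
      (lineIntegral c f p q : ℝ) = g q - g p - (φ (f q) - φ (f p)) := by
    have same_difference := sub_eq_sub_of_fourierChar_eq (map_continuous (t (f.comp (seg p q))))
      (map_continuous (g.comp (seg p q))) (fun s => (ht _ s).trans (hg _).symm) (v 1) (v 0)
    have start : seg p q (v 0) = p := by simp [seg_apply, v]
    have finish : seg p q (v 1) = q := by simp [seg_apply, v]
    have value := hc (f.comp (seg p q))
    simp only [ContinuousMap.comp_apply, start, finish] at same_difference value
    rw [lineIntegral, ← value]
    linarith
  refine ⟨c, isCocycle_of_lineIntegral_add fun f p q r => ?_, fun m f p => ?_⟩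
  · obtain ⟨g, hg⟩ := exists_lift isCoveringMap_fourierChar fourierChar_surjective (F.comp f)
    rify
    rw [lineIntegral_eq f hg, lineIntegral_eq f hg, lineIntegral_eq f hg]
    ring
  · obtain ⟨g, hg⟩ := exists_lift isCoveringMap_fourierChar fourierChar_surjective (F.comp f)
    convert (map_continuous g).fun_sub (continuous_const (y := g p - φ (f p))) using 2 with x
    rw [lineIntegral_eq f hg]
    ring

end Lift

section Represents

variable {Y : Type u} [TopologicalSpace Y] {σ : C(Y, Y)} {ε : ℤ} {F G : C(Y, Circle)}
  {c d : Cochain Y 1}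

/-- The cocycle `c` represents the map `F` to the circle: some lift `φ` of `F` to the real numbers,
not necessarily continuous but multiplied by `ε` under `σ`, is a primitive of `c`. -/
def Represents (σ : C(Y, Y)) (ε : ℤ) (F : C(Y, Circle)) (c : Cochain Y 1) : Prop :=
  IsCocycle c ∧ ∃ φ : Y → ℝ, (∀ y, φ (σ y) = ε * φ y) ∧ (∀ y, 𝐞 (φ y) = F y) ∧ IsPrimitive φ c

namespace Represents

theorem mul (h : Represents σ ε F c) (h' : Represents σ ε G d) :
    Represents σ ε (F * G) (c + d) := by
  obtain ⟨hc, φ, φ_σ, φ_lift, hφ⟩ := h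
  obtain ⟨hd, ψ, ψ_σ, ψ_lift, hψ⟩ := h'
  refine ⟨by rw [IsCocycle, map_add, hc, hd, add_zero], φ + ψ, fun y => ?_, fun y => ?_, hφ.add hψ⟩
  · simp only [Pi.add_apply, φ_σ, ψ_σ, mul_add]
  · simp only [Pi.add_apply, AddChar.map_add_eq_mul, φ_lift, ψ_lift, ContinuousMap.mul_apply]

theorem inv (h : Represents σ ε F c) : Represents σ ε F⁻¹ (-c) := by
  obtain ⟨hc, φ, φ_σ, φ_lift, hφ⟩ := h
  refine ⟨by rw [IsCocycle, map_neg, hc, neg_zero], -φ, fun y => ?_, fun y => ?_, by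
    simpa only [neg_one_zsmul] using hφ.zsmul (-1)⟩
  · simp only [Pi.neg_apply, φ_σ, mul_neg]
  · simp only [Pi.neg_apply, AddChar.map_neg_eq_inv, φ_lift, ContinuousMap.inv_apply]

theorem mem_signedCochains (h : Represents σ ε F c) : c ∈ signedCochains σ ε 1 := by
  obtain ⟨hc, φ, φ_σ, -, hφ⟩ := h
  have φ_comp_σ : φ ∘ σ = ε • φ := funext fun y => by simp [φ_σ]
  refine IsPrimitive.unique (hc.pullback σ) ?_ (hφ.pullback σ) (φ_comp_σ ▸ hφ.zsmul ε)
  exact (map_zsmul _ ε c).trans (by rw [hc, smul_zero])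

end Represents

theorem represents_one_iff :
    Represents σ ε 1 c ↔ c ∈ coboundaries (signedCochains σ ε) 1 := by
  constructor
  · rintro ⟨hc, φ, φ_σ, φ_lift, hφ⟩
    choose n hn using fun y => fourierChar_eq_one_iff.1 (φ_lift y)
    have n_σ (y : Y) : n (σ y) = ε * n y := by exact_mod_cast (hn y ▸ hn (σ y) ▸ φ_σ y :)
    let b : Cochain Y 0 := fun s => -n (s default)
    have hb : IsPrimitive φ (coboundary Y 0 b) := by
      convert (IsPrimitive.coboundary b).zsmul (-1) using 1
      · ext y
        simp [b, hn]
      · simp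
    refine ⟨b, funext fun s => ?_, IsPrimitive.unique (isCocycle_coboundary b) hc hb hφ⟩
    change -n (σ (s default)) = ε * -n (s default)
    rw [n_σ, mul_neg]
  · rintro ⟨b, hb, rfl⟩
    refine ⟨isCocycle_coboundary b, fun y => ((-b (.const _ y) : ℤ) : ℝ), fun y => ?_,
      fun y => fourierChar_intCast _, ?_⟩
    · have at_point : b (.const _ (σ y)) = ε * b (.const _ y) := congrFun hb (.const _ y)
      simp [at_point]
    · convert (IsPrimitive.coboundary b).zsmul (-1) using 1
      · ext y
        simp
      · simp

theorem exists_equivariant_lift (hσ : Function.Involutive σ) (free : ∀ y, σ y ≠ y)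
    (hε : ε * ε = 1) (hF : ∀ y, F (σ y) = F y ^ ε) :
    ∃ φ : Y → ℝ, (∀ y, φ (σ y) = ε * φ y) ∧ ∀ y, 𝐞 (φ y) = F y := by
  classical
  choose ψ hψ using fun y => fourierChar_surjective (F y)
  let rep (y : Y) : Y := Quotient.out (Quotient.mk (orbitSetoid σ hσ) y)
  have rep_σ (y : Y) : rep (σ y) = rep y :=
    congrArg Quotient.out (Quotient.sound (s := orbitSetoid σ hσ) (Or.inr (hσ y)))
  have rep_eq (y : Y) : rep y = y ∨ rep y = σ y :=
    (Quotient.mk_out (s := orbitSetoid σ hσ) y).imp_right hσ.eq_iff.1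
  refine ⟨fun y => if rep y = y then ψ y else ε * ψ (σ y), fun y => ?_, fun y => ?_⟩
  · obtain h | h := rep_eq y
    · simp [rep_σ, h, hσ y, (free y).symm]
    · simp [rep_σ, h, free y, ← mul_assoc, show (ε * ε : ℝ) = 1 by exact_mod_cast hε]
  · beta_reduce
    split_ifs
    · exact hψ y
    · rw [fourierChar_intCast_mul, hψ, ← hF, hσ]

theorem exists_represents (hσ : Function.Involutive σ) (free : ∀ y, σ y ≠ y) (hε : ε * ε = 1)
    (hF : ∀ y, F (σ y) = F y ^ ε) : ∃ c, Represents σ ε F c := by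
  obtain ⟨φ, φ_σ, φ_lift⟩ := exists_equivariant_lift hσ free hε hF
  obtain ⟨c, hc, hφ⟩ := exists_isPrimitive_of_lift φ_lift
  exact ⟨c, hc, φ, φ_σ, φ_lift, hφ⟩

end Represents

/-! ### Cocycles on the product with a contractible space -/

section Product

variable {E : Type v} [TopologicalSpace E] {X : Type u} [TopologicalSpace X]

theorem exists_isPrimitive_prod [ContractibleSpace E] [T2Space X] [CWComplex (univ : Set X)]
    {c : Cochain (E × X) 1} (hc : IsCocycle c) :
    ∃ φ : E × X → ℝ, IsPrimitive φ c ∧ ∀ (γ : C(ℝ, E)) (x : X) (s t : ℝ),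
      φ (γ t, x) + lineIntegral c (γ.prodMk (.const ℝ x)) s t = φ (γ s, x) := by
  obtain ⟨e, ⟨H⟩⟩ := id_nullhomotopic E
  let incl : C(X, E × X) := (ContinuousMap.const X e).prodMk (.id X)
  let contraction : C((E × X) × ℝ, E × X) :=
    ⟨fun z => (H (projIcc 0 1 zero_le_one z.2, z.1.1), z.1.2), by fun_prop⟩
  let track (y : E × X) : C(ℝ, E × X) := contraction.comp ((ContinuousMap.const ℝ y).prodMk (.id ℝ))
  obtain ⟨h, hh⟩ := exists_isPrimitive (hc.pullback incl)
  refine ⟨fun y => h y.2 + lineIntegral c (track y) 0 1, fun m f => ?_, fun γ x s t => ?_⟩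
  · let F : C((Fin m → ℝ) × ℝ, E × X) := contraction.comp (f.prodMap (.id ℝ))
    have along_track (x : Fin m → ℝ) :
        lineIntegral c (track (f x)) 0 1 = lineIntegral c F (x, 0) (x, 1) :=
      lineIntegral_eq_of_forall c fun s => by simp [F, track, seg_apply_eq_add_smul]
    refine IsPrimitiveAlong.of_homotopy hc F (g := incl.comp (ContinuousMap.snd.comp f))
      (ψ := h ∘ Prod.snd) (fun x => by simp [F, contraction])
      (fun x => by simp [F, contraction, incl]) (hh m (ContinuousMap.snd.comp f)) ?_
    simpa [along_track, incl] using continuous_const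
  · let F : C(ℝ × ℝ, E × X) :=
      contraction.comp (((γ.prodMk (.const ℝ x)).comp .fst).prodMk .snd)
    have bottom : lineIntegral c F (s, 0) (t, 0) = lineIntegral c (γ.prodMk (.const ℝ x)) s t :=
      lineIntegral_eq_of_forall c fun r => by simp [F, contraction, seg_apply_eq_add_smul]
    have top : lineIntegral c F (s, 1) (t, 1) = 0 :=
      hc.lineIntegral_of_forall_eq (y := (e, x)) fun r => by
        simp [F, contraction, seg_apply_eq_add_smul]
    have side (r : ℝ) : lineIntegral c (track (γ r, x)) 0 1 = lineIntegral c F (r, 0) (r, 1) :=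
      lineIntegral_eq_of_forall c fun s => by simp [F, track, seg_apply_eq_add_smul]
    have square : lineIntegral c (γ.prodMk (.const ℝ x)) s t + lineIntegral c (track (γ t, x)) 0 1 =
        lineIntegral c (track (γ s, x)) 0 1 := by
      rw [side, side, ← bottom, hc.lineIntegral_add, ← hc.lineIntegral_add F _ (s, 1), top,
        add_zero]
    rify at square
    linarith

variable {τ : C(E, E)} {ι : C(X, X)} {ε : ℤ} {c : Cochain (E × X) 1}

/-- The values of a primitive `φ` at `(e, x)` and `(e', x)` differ by an integer `n`, and those of
`φ ∘ σ` by `ε n`, so the average of `φ` and `ε (φ ∘ σ)` still has values that differ by `n`. -/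
theorem exists_equivariant_isPrimitive_prod [ContractibleSpace E] [T2Space X]
    [CWComplex (univ : Set X)] (hτ : Function.Involutive τ) (hι : Function.Involutive ι)
    (hε : ε * ε = 1) (hc : IsCocycle c) (hcσ : c ∈ signedCochains (diagonal τ ι) ε 1) :
    ∃ φ : E × X → ℝ, IsPrimitive φ c ∧ (∀ y, φ (diagonal τ ι y) = ε * φ y) ∧
      ∀ e e' x, 𝐞 (φ (e, x)) = 𝐞 (φ (e', x)) := by
  have hε' : (ε * ε : ℝ) = 1 := by exact_mod_cast hε
  obtain ⟨φ, hφ, φ_slice⟩ := exists_isPrimitive_prod hc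
  have hφσ : IsPrimitive (ε • (φ ∘ diagonal τ ι)) c := by
    convert (hφ.pullback (diagonal τ ι)).zsmul ε
    rw [mem_signedCochains.1 hcσ, smul_smul, hε, one_smul]
  refine ⟨_, hφ.midpoint hφσ, fun y => ?_, fun e e' x => ?_⟩
  · have involutive := diagonal_involutive hτ hι y
    simp only [Pi.smul_apply, Function.comp_apply, involutive, zsmul_eq_mul]
    linear_combination -(φ (diagonal τ ι y) / 2) * hε'
  · let γ : C(ℝ, E) := ⟨(PathConnectedSpace.somePath e e').extend, by fun_prop⟩
    have start : γ 0 = e := by simp [γ]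
    have finish : γ 1 = e' := by simp [γ]
    let n := lineIntegral c (γ.prodMk (.const ℝ x)) 0 1
    have slice : φ (e', x) + n = φ (e, x) := by
      simpa only [start, finish] using φ_slice γ x 0 1
    have translated_slice : φ (τ e', ι x) + ε * n = φ (τ e, ι x) := by
      have integral : lineIntegral c ((τ.comp γ).prodMk (.const ℝ (ι x))) 0 1 = ε * n :=
        congrFun hcσ ((γ.prodMk (.const ℝ x)).comp (seg 0 1))
      have := φ_slice (τ.comp γ) (ι x) 0 1
      rw [integral] at this
      simpa [start, finish] using this
    have difference : (φ (e, x) + ε * φ (τ e, ι x)) / 2 =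
        (φ (e', x) + ε * φ (τ e', ι x)) / 2 + n := by
      linear_combination -(slice + ε * translated_slice) / 2 + n / 2 * hε'
    simp [difference, AddChar.map_add_eq_mul, fourierChar_intCast]

theorem exists_represents_comp_snd [ContractibleSpace E] [T2Space X] [CWComplex (univ : Set X)]
    (hτ : Function.Involutive τ) (hι : Function.Involutive ι) (hε : ε * ε = 1) (hc : IsCocycle c)
    (hcσ : c ∈ signedCochains (diagonal τ ι) ε 1) :
    ∃ f : C(X, Circle), IsEquivariant ι (zpowGroupHom ε) f ∧
      Represents (diagonal τ ι) ε (f.comp .snd) c := by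
  obtain ⟨φ, hφ, φ_σ, φ_const⟩ := exists_equivariant_isPrimitive_prod hτ hι hε hc hcσ
  obtain ⟨e⟩ := (inferInstance : Nonempty E)
  have := deltaGeneratedSpace_of_cwComplex X
  let f : C(X, Circle) := ⟨fun x => 𝐞 (φ (e, x)),
    (hφ.pullback ((ContinuousMap.const X e).prodMk (.id X))).continuous_fourierChar⟩
  refine ⟨f, fun x => ?_, hc, φ, φ_σ, fun y => φ_const _ _ _, hφ⟩
  calc 𝐞 (φ (e, ι x)) = 𝐞 (φ (τ e, ι x)) := φ_const _ _ _
    _ = 𝐞 (ε * φ (e, x)) := by rw [← φ_σ]; rfl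
    _ = 𝐞 (φ (e, x)) ^ ε := fourierChar_intCast_mul _ _

theorem represents_comp_snd_zero_iff [PathConnectedSpace E] [DeltaGeneratedSpace X]
    {f : C(X, Circle)} : Represents (diagonal τ ι) ε (f.comp .snd) 0 ↔
      ∃ k : C(X, ℝ), (∀ x, k (ι x) = ε * k x) ∧ ∀ x, 𝐞 (k x) = f x := by
  constructor
  · rintro ⟨-, φ, φ_σ, φ_lift, hφ⟩
    obtain ⟨e⟩ := (inferInstance : Nonempty E)
    have φ_const (e' : E) (x : X) : φ (e, x) = φ (e', x) := by
      let γ := PathConnectedSpace.somePath e e'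
      let f : C(Fin 1 → ℝ, E × X) := ⟨fun t => (γ.extend (t 0), x), by fun_prop⟩
      have := sub_eq_sub_of_fourierChar_eq (hφ.continuous_comp f)
        (continuous_const (y := φ (e, x))) (fun t => by simp [φ_lift, f]) 1 0
      simpa [f, eq_comm (a := φ (e, x)), sub_eq_zero] using this
    let k : C(X, ℝ) := ⟨fun x => φ (e, x),
      (hφ.pullback ((ContinuousMap.const X e).prodMk (.id X))).continuous⟩
    refine ⟨k, fun x => ?_, fun x => φ_lift (e, x)⟩
    exact (φ_const (τ e) (ι x)).trans (φ_σ (e, x))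
  · rintro ⟨k, k_ι, k_lift⟩
    exact ⟨map_zero _, k ∘ Prod.snd, fun y => k_ι y.2, fun y => k_lift y.2,
      IsPrimitive.of_continuous (k.continuous.comp continuous_snd)⟩

end Product

section Homotopy

variable {X : Type u} [TopologicalSpace X] {ι : C(X, X)} {ε : ℤ} {f g : C(X, Circle)}

theorem homotopicWith_isEquivariant_iff (hf : IsEquivariant ι (zpowGroupHom ε) f) :
    ContinuousMap.HomotopicWith f g (IsEquivariant ι (zpowGroupHom ε)) ↔
      ∃ k : C(X, ℝ), (∀ x, k (ι x) = ε * k x) ∧ ∀ x, 𝐞 (k x) = (f⁻¹ * g) x := by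
  constructor
  · rintro ⟨F⟩
    let H : C(unitInterval × X, Circle) := ⟨fun z => (F (0, z.2))⁻¹ * F z, by fun_prop⟩
    have H_zero (x : X) : H (0, x) = 𝐞 ((0 : C(X, ℝ)) x) := by simp [H]
    have H_ι (t : unitInterval) (x : X) : H (t, ι x) = H (t, x) ^ ε := by
      have F_ι (t : unitInterval) : F (t, ι x) = F (t, x) ^ ε := F.prop t x
      simp only [H, ContinuousMap.coe_mk, F_ι, mul_zpow, inv_zpow]
    let K : C(unitInterval × X, ℝ) := isCoveringMap_fourierChar.liftHomotopy H 0 H_zero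
    have K_lift (z : unitInterval × X) : 𝐞 (K z) = H z :=
      congrFun (isCoveringMap_fourierChar.liftHomotopy_lifts H 0 H_zero) z
    have K_zero (x : X) : K (0, x) = 0 :=
      isCoveringMap_fourierChar.liftHomotopy_zero H 0 H_zero x
    refine ⟨⟨fun x => K (1, x), by fun_prop⟩, fun x => ?_, fun x => ?_⟩
    · simpa [K_zero, sub_eq_zero] using sub_eq_sub_of_fourierChar_eq
        (f := fun t => K (t, ι x)) (g := fun t => ε * K (t, x)) (by fun_prop) (by fun_prop)
        (fun t => by rw [fourierChar_intCast_mul, K_lift, K_lift, H_ι]) 1 0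
    · simp [K_lift, H]
  · rintro ⟨k, k_ι, k_lift⟩
    refine ⟨⟨⟨⟨fun z => f z.2 * 𝐞 (z.1 * k z.2), by fun_prop⟩, fun x => by simp,
      fun x => by simp [k_lift]⟩, fun t x => ?_⟩⟩
    change f (ι x) * 𝐞 (t * k (ι x)) = (f x * 𝐞 (t * k x)) ^ ε
    rw [hf x, k_ι, mul_left_comm, fourierChar_intCast_mul, mul_zpow, zpowGroupHom_apply]

end Homotopy

section Correspondence

theorem nonempty_quotient_addEquiv {G A : Type*} [Group G] [AddGroup A] (r : Con G)
    (B : AddSubgroup A) [B.Normal] (R : G → A → Prop)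
    (mul : ∀ {f g a b}, R f a → R g b → R (f * g) (a + b)) (inv : ∀ {f a}, R f a → R f⁻¹ (-a))
    (left_total : ∀ f, ∃ a, R f a) (right_total : ∀ a, ∃ f, R f a)
    (rel_iff : ∀ f g, r f g ↔ R (f⁻¹ * g) 0) (mem_iff : ∀ a, a ∈ B ↔ R 1 a) :
    Nonempty (A ⧸ B ≃+ Additive r.Quotient) := by
  choose f hf using right_total
  have unique {g h : G} {a : A} (hg : R g a) (hh : R h a) : (g : r.Quotient) = h := by
    rw [r.eq, rel_iff, ← neg_add_cancel a]
    exact mul (inv hg) hh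
  let Φ : A →+ Additive r.Quotient :=
    AddMonoidHom.mk' (fun a => .ofMul (f a : r.Quotient)) fun a b =>
      congrArg Additive.ofMul (unique (hf (a + b)) (mul (hf a) (hf b)))
  have surjective : Function.Surjective Φ := by
    intro q
    obtain ⟨g, hg⟩ := Con.mk'_surjective q.toMul
    obtain ⟨a, ha⟩ := left_total g
    exact ⟨a, (unique (hf a) ha).trans hg⟩
  have ker_eq : Φ.ker = B := by
    ext a
    rw [mem_iff]
    refine ⟨fun h => ?_, fun h => unique (hf a) h⟩
    have := mul (hf a) ((rel_iff _ _).1 (r.eq.1 h))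
    rwa [mul_one, mul_inv_cancel, add_zero] at this
  exact ⟨(QuotientAddGroup.quotientAddEquivOfEq ker_eq.symm).trans
    (QuotientAddGroup.quotientKerEquivOfSurjective Φ surjective)⟩

variable {E : Type v} [TopologicalSpace E] {X : Type u} [TopologicalSpace X] [T2Space X]
  [CWComplex (univ : Set X)] {τ : C(E, E)} {ι : C(X, X)} {ε : ℤ}

theorem nonempty_cohomology_signedCochains_addEquiv [ContractibleSpace E]
    (hτ : Function.Involutive τ) (hι : Function.Involutive ι) (free : ∀ e, τ e ≠ e)
    (hε : ε * ε = 1) :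
    Nonempty (Cohomology (signedCochains (diagonal τ ι) ε) 1 ≃+
      Additive (HomotopyClasses ι (zpowGroupHom ε))) := by
  have := deltaGeneratedSpace_of_cwComplex X
  refine nonempty_quotient_addEquiv _ _
    (fun f c => Represents (diagonal τ ι) ε (f.1.comp .snd) c.1) .mul .inv (fun f => ?_)
    (fun c => ?_) (fun f g => ?_) (fun c => ?_)
  · obtain ⟨c, hc⟩ := exists_represents (F := f.1.comp .snd) (diagonal_involutive hτ hι)
      (fun y h => free y.1 (congrArg Prod.fst h)) hε fun y => f.2 y.2
    exact ⟨⟨c, hc.mem_signedCochains, hc.1⟩, hc⟩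
  · obtain ⟨f, hf, hfc⟩ := exists_represents_comp_snd hτ hι hε c.2.2 c.2.1
    exact ⟨⟨f, hf⟩, hfc⟩
  · exact (homotopicWith_isEquivariant_iff f.2).trans represents_comp_snd_zero_iff.symm
  · exact AddSubgroup.mem_addSubgroupOf.trans represents_one_iff.symm

end Correspondence

/-! ### The quotient by a free involution -/

section Quotient

variable {Y : Type u} [TopologicalSpace Y]

theorem nonempty_cohomology_addEquiv_of_pullback {Z : Type v} [TopologicalSpace Z] {f : C(Y, Z)}
    {A : ∀ n, AddSubgroup (Cochain Z n)} {B : ∀ n, AddSubgroup (Cochain Y n)}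
    (inj : ∀ n, Function.Injective (pullback f n)) (map_eq : ∀ n, (A n).map (pullback f n) = B n)
    (n : ℕ) : Nonempty (Cohomology A n ≃+ Cohomology B n) := by
  have cocycles_eq : (cocycles A n).map (pullback f n) = cocycles B n := by
    ext c
    rw [cocycles, cocycles, ← map_eq]
    constructor
    · rintro ⟨c, ⟨hc, hc'⟩, rfl⟩
      exact ⟨⟨c, hc, rfl⟩, (coboundary_pullback f n c).trans
        ((congrArg _ hc').trans (map_zero _))⟩
    · rintro ⟨⟨c, hc, rfl⟩, hc'⟩
      exact ⟨c, ⟨hc, inj _ ((coboundary_pullback f n c).symm.trans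
        (hc'.trans (map_zero _).symm))⟩, rfl⟩
  have coboundaries_eq : (coboundaries A n).map (pullback f n) = coboundaries B n := by
    cases n with
    | zero => exact AddSubgroup.map_bot _
    | succ n =>
      rw [coboundaries, coboundaries, ← map_eq, AddSubgroup.map_map, AddSubgroup.map_map]
      rfl
  let e : cocycles A n ≃+ cocycles B n :=
    ((cocycles A n).equivMapOfInjective _ (inj n)).trans (AddEquiv.addSubgroupCongr cocycles_eq)
  refine ⟨QuotientAddGroup.congr _ _ e ?_⟩
  ext c
  obtain ⟨d, rfl⟩ := e.surjective c
  refine (AddSubgroup.mem_map_iff_mem (f := e.toAddMonoidHom) e.injective).trans ?_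
  rw [AddSubgroup.mem_addSubgroupOf, AddSubgroup.mem_addSubgroupOf, ← coboundaries_eq]
  exact (AddSubgroup.mem_map_iff_mem (inj n)).symm

variable {σ : C(Y, Y)} (hσ : Function.Involutive σ)

/-- The projection of a space to its quotient by an involution. -/
def orbitProj : C(Y, Quotient (orbitSetoid σ hσ)) := ⟨Quotient.mk _, continuous_quotient_mk'⟩

theorem orbitProj_eq_iff {y z : Y} : orbitProj hσ y = orbitProj hσ z ↔ y = z ∨ σ y = z :=
  Quotient.eq

theorem orbitProj_surjective : Function.Surjective (orbitProj hσ) := Quotient.mk_surjective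

theorem orbitProj_comp : (orbitProj hσ).comp σ = orbitProj hσ :=
  ContinuousMap.ext fun y => (orbitProj_eq_iff hσ).2 (Or.inr (hσ y))

/-- The action of the group of order two generated by an involution. -/
abbrev involutionAction : MulAction ℤˣ Y where
  smul g y := if g = 1 then y else σ y
  one_smul y := if_pos rfl
  mul_smul g h y := by
    change (if g * h = 1 then y else σ y) =
      if g = 1 then (if h = 1 then y else σ y) else σ (if h = 1 then y else σ y)
    obtain rfl | rfl := Int.units_eq_one_or g <;> obtain rfl | rfl := Int.units_eq_one_or h <;>
      simp [hσ y]

theorem isCoveringMap_orbitProj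
    (disj : ∀ y : Y, ∃ U : Set Y, IsOpen U ∧ y ∈ U ∧ Disjoint U (σ '' U)) :
    IsCoveringMap (orbitProj hσ) := by
  let _ := involutionAction hσ
  have neg_one_smul (y : Y) : (-1 : ℤˣ) • y = σ y := if_neg (by decide)
  have isQuotientCoveringMap : IsQuotientCoveringMap (orbitProj hσ) ℤˣ :=
    { isQuotientMap_quotient_mk' with
      continuous_const_smul := fun g => by
        obtain rfl | rfl := Int.units_eq_one_or g
        · simpa only [one_smul] using continuous_id'
        · simpa only [neg_one_smul] using map_continuous σ
      apply_eq_iff_mem_orbit := fun {y z} => by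
        rw [orbitProj_eq_iff, MulAction.mem_orbit_iff]
        constructor
        · rintro (rfl | rfl)
          · exact ⟨1, one_smul _ _⟩
          · exact ⟨-1, (neg_one_smul _).trans (hσ _)⟩
        · rintro ⟨g, rfl⟩
          obtain rfl | rfl := Int.units_eq_one_or g
          · exact Or.inl (one_smul _ _)
          · exact Or.inr ((congrArg σ (neg_one_smul _)).trans (hσ _))
      disjoint := fun y => by
        obtain ⟨U, hU, hy, hd⟩ := disj y
        refine ⟨U, hU.mem_nhds hy, fun g hg => ?_⟩
        obtain rfl | rfl := Int.units_eq_one_or g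
        · rfl
        · simp only [neg_one_smul] at hg
          exact absurd hd.symm (not_disjoint_iff_nonempty_inter.2 hg) }
  exact isQuotientCoveringMap.isCoveringMap

variable {hσ}

theorem eq_or_comp_eq_of_orbitProj_comp_eq (hcov : IsCoveringMap (orbitProj hσ)) {n : ℕ}
    {s t : SingularSimplex Y n} (h : (orbitProj hσ).comp s = (orbitProj hσ).comp t) :
    s = t ∨ σ.comp s = t := by
  let v : stdSimplex ℝ (Fin (n + 1)) := stdSimplex.vertex 0
  have unique {s : SingularSimplex Y n} (h : (orbitProj hσ).comp s = (orbitProj hσ).comp t)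
      (hv : s v = t v) : s = t :=
    DFunLike.coe_injective
      (hcov.eq_of_comp_eq s.continuous t.continuous (congrArg DFunLike.coe h) v hv)
  refine ((orbitProj_eq_iff hσ).1 (congrArg (· v) h)).imp (unique h) (unique ?_)
  rw [← ContinuousMap.comp_assoc, orbitProj_comp, h]

theorem pullback_orbitProj_injective (hcov : IsCoveringMap (orbitProj hσ)) (n : ℕ) :
    Function.Injective (pullback (orbitProj hσ) n) := by
  intro c d h
  funext s
  obtain ⟨t, ht⟩ := exists_lift_simplex hcov (orbitProj_surjective hσ) s
  obtain rfl : (orbitProj hσ).comp t = s := ContinuousMap.ext ht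
  exact congrFun h t

theorem range_pullback_orbitProj (hcov : IsCoveringMap (orbitProj hσ)) (n : ℕ) :
    (pullback (orbitProj hσ) n).range = signedCochains σ 1 n := by
  ext c
  rw [mem_signedCochains, one_zsmul]
  constructor
  · rintro ⟨d, rfl⟩
    funext s
    change d ((orbitProj hσ).comp (σ.comp s)) = d ((orbitProj hσ).comp s)
    rw [← ContinuousMap.comp_assoc, orbitProj_comp]
  · intro hc
    choose t ht using fun s : SingularSimplex (Quotient (orbitSetoid σ hσ)) n =>
      exists_lift_simplex hcov (orbitProj_surjective hσ) s
    refine ⟨fun s => c (t s), funext fun s => ?_⟩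
    obtain h | h := eq_or_comp_eq_of_orbitProj_comp_eq hcov
      (ContinuousMap.ext (ht ((orbitProj hσ).comp s)))
    · exact congrArg c h
    · exact (congrFun hc _).symm.trans (congrArg c h)

theorem nonempty_singularCohomology_quotient_addEquiv (hσ : Function.Involutive σ)
    (disj : ∀ y : Y, ∃ U : Set Y, IsOpen U ∧ y ∈ U ∧ Disjoint U (σ '' U)) (n : ℕ) :
    Nonempty (SingularCohomology (Quotient (orbitSetoid σ hσ)) n ≃+
      Cohomology (signedCochains σ 1) n) :=
  have hcov := isCoveringMap_orbitProj hσ disj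
  nonempty_cohomology_addEquiv_of_pullback (pullback_orbitProj_injective hcov)
    (fun n => (AddMonoidHom.range_eq_map _).symm.trans (range_pullback_orbitProj hcov n)) n

end Quotient

theorem exists_disjoint_image_prodMap {E : Type*} [TopologicalSpace E] {X : Type*}
    [TopologicalSpace X] {τ : E → E} (ι : X → X)
    (h : ∀ e : E, ∃ U : Set E, IsOpen U ∧ e ∈ U ∧ Disjoint U (τ '' U)) (y : E × X) :
    ∃ U : Set (E × X), IsOpen U ∧ y ∈ U ∧ Disjoint U (Prod.map τ ι '' U) := by
  obtain ⟨U, hU, hy, hd⟩ := h y.1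
  refine ⟨Prod.fst ⁻¹' U, hU.preimage continuous_fst, hy, disjoint_left.2 ?_⟩
  rintro _ hz ⟨z, hzU, rfl⟩
  exact disjoint_left.1 hd hz ⟨z.1, hzU, rfl⟩

theorem IsUniversalFree.apply_ne {E : Type v} [TopologicalSpace E] {τ : C(E, E)}
    (hτ : IsUniversalFree τ) (e : E) : τ e ≠ e := by
  obtain ⟨U, -, he, hd⟩ := hτ.exists_disjoint e
  exact fun h => disjoint_left.1 hd he ⟨e, he, h⟩

theorem zpowGroupHom_one : (zpowGroupHom 1 : Circle →* Circle) = MonoidHom.id Circle := by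
  ext z
  simp

theorem zpowGroupHom_neg_one : (zpowGroupHom (-1) : Circle →* Circle) = circleConj := by
  ext z
  rw [zpowGroupHom_apply, zpow_neg_one, Circle.coe_inv_eq_conj]
  rfl

end EquivCoh

end

theorem mainTheorem11_general {X : Type*} [TopologicalSpace X] [T2Space X]
    (ι : C(X, X)) (hι : Function.Involutive ι) [Topology.CWComplex (Set.univ : Set X)]
    {E : Type*} [TopologicalSpace E] (τ : C(E, E)) (hτ : EquivCoh.IsUniversalFree τ) :
    Nonempty (EquivCoh.BorelCohomology τ ι hτ.involutive hι 1 ≃+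
        Additive (EquivCoh.HomotopyClasses ι (MonoidHom.id Circle))) ∧
      Nonempty (EquivCoh.TwistedBorelCohomology τ ι 1 ≃+
        Additive (EquivCoh.HomotopyClasses ι EquivCoh.circleConj)) := by
  have := hτ.contractible
  have signed {ε : ℤ} (hε : ε * ε = 1) :=
    EquivCoh.nonempty_cohomology_signedCochains_addEquiv hτ.involutive hι hτ.apply_ne hε
  constructor
  · obtain ⟨borel⟩ := EquivCoh.nonempty_singularCohomology_quotient_addEquiv
      (EquivCoh.diagonal_involutive hτ.involutive hι)
      (EquivCoh.exists_disjoint_image_prodMap ι hτ.exists_disjoint) 1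
    obtain ⟨e⟩ := signed (one_mul 1)
    rw [EquivCoh.zpowGroupHom_one] at e
    exact ⟨borel.trans e⟩
  · obtain ⟨e⟩ := signed (ε := -1) (by norm_num)
    rw [EquivCoh.zpowGroupHom_neg_one, ← EquivCoh.antiInvariantCochains_eq] at e
    exact ⟨e⟩

theorem mainTheorem11 {X : Type*} [TopologicalSpace X] [T2Space X]
    (ι : C(X, X)) (hι : Function.Involutive ι)
    [Topology.CWComplex (Set.univ : Set X)] (hX : EquivCoh.IsZ2CW ι)
    {E : Type*} [TopologicalSpace E] (τ : C(E, E)) (hτ : EquivCoh.IsUniversalFree τ) :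
    Nonempty (EquivCoh.BorelCohomology τ ι hτ.involutive hι 1 ≃+
        Additive (EquivCoh.HomotopyClasses ι (MonoidHom.id Circle))) ∧
      Nonempty (EquivCoh.TwistedBorelCohomology τ ι 1 ≃+
        Additive (EquivCoh.HomotopyClasses ι EquivCoh.circleConj)) :=
  mainTheorem11_general ι hι τ hτ
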